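/- **Definitions.** A *pseudo-effect algebra* (PEA) is a set $E$ with a partial binary operation $+$ and constants $0,1$ such that for all $a,b,c\in E$: (1) $a+b$ and $(a+b)+c$ exist iff $b+c$ and $a+(b+c)$ exist, and then $(a+b)+c=a+(b+c)$; (2) there are exactly one $d$ and exactly one $e$ in $E$ with $a+d=e+a=1$ (write $a^{\sim}=d$, $a^{-}=e$); (3) if $a+b$ exists, there are $d,e\in E$ with $a+b=d+a=b+e$; (4) if $a+1$ or $1+a$ exists, then $a=0$. Put $a\leqslant b$ iff $a+c=b$ for some $c\in E$. A homomorphism of PEAs preserves $0$ and $1$, and whenever $a+b$ exists, $f(a)+f(b)$ exists and equals $f(a+b)$. An *ideal* is a nonempty subset $I\subseteq E$ that is downward closed and contains $i+j$ whenever $i,j\in I$ and $i+j$ exists; it is *maximal* if $1\notin I$ and it is not properly included in an ideal not containing $1$. $E$ has *(RDP)$_1$* if, whenever $a_1+a_2=b_1+b_2$ in $E$, there are $c_{11},c_{12},c_{21},c_{22}\in E$ with $a_1=c_{11}+c_{12}$, $a_2=c_{21}+c_{22}$, $b_1=c_{11}+c_{21}$, $b_2=c_{12}+c_{22}$, such that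 for all $x\leqslant c_{12}$ and $y\leqslant c_{21}$ both $x+y$ and $y+x$ exist and are equal. A *po-group* is a (not necessarily commutative) additive group with a translation-invariant partial order; po-group homomorphisms are order-preserving group homomorphisms. It is *directed* if any two elements have a common upper bound, *torsion-free* if $kg\neq 0$ for all $g\neq 0$ and all integers $k\ne 0$, and it has *(RDP)$_1$* if its positive cone $\{g\mid g\geqslant 0\}$, with the restricted addition and order, satisfies the condition above. A *strong unit* is an element $u\geqslant 0$ such that every $g$ satisfies $g\leqslant ku$ for some integer $k\geq 1$; the pair $(H,u)$ is then a *unital po-group*. For $u\geqslant 0$ in a po-group $H$, $\Gamma(H,u)=\{x\in H\mid 0\leqslant x\leqslant u\}$ is the PEA with constants $0,u$ in which $a+b$ is defined iff $a\leqslant u-b$, and is then the sum in $H$. $\mathbb Z\overrightarrow{\times}G$ is the group $\mathbb Z\times G$ with the lexicographic order. Let $n\ge 1$. An *$n$-decomposition* of a PEA $E$ is a tuple $(E_0,\dots,E_n)$ of nonempty pairwise disjoint subsets with union $E$ such that, for all $i,j$, $\{x^-\mid x\in E_i\}=\{x^\sim\mid x\in E_i\}=E_{n-i}$, and whenever $x\in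 E_i$, $y\in E_j$ and $x+y$ exists, then $i+j\le n$ and $x+y\in E_{i+j}$. $E$ is *$n$-perfect* if it has an $n$-decomposition such that $x+y$ exists for all $x\in E_i$, $y\in E_j$ with $i+j<n$, and such that $E_0$ is the unique maximal ideal of $E$. $E$ is *strong $n$-perfect* if it is $n$-perfect with such a decomposition $(E_0,\dots,E_n)$, has (RDP)$_1$, and there are a torsion-free unital po-group $(H,u)$ with an identification (isomorphism) $E=\Gamma(H,u)$ and an element $c\in E_1$ with $nc=u$ and $c+x=x+c$ for all $x\in H$. **Theorem.** Let $n\geq 1$. Let $\mathcal G$ be the category of torsion-free directed po-groups $G$ such that $\mathbb Z\overrightarrow{\times}G$ has (RDP)$_1$, with po-group homomorphisms, and let $\mathcal{SPPEA}_n$ be the category of strong $n$-perfect PEAs, with PEA homomorphisms. Then the functor $\mathcal E_n:\mathcal G\to\mathcal{SPPEA}_n$ given by $\mathcal E_n(G)=\Gamma(\mathbb Z\overrightarrow{\times}G,(n,0))$ and $\mathcal E_n(h)(i,g)=(i,h(g))$ is a categorical equivalence, that is, it is full, faithful, and every strong $n$-perfect PEA is isomorphic to some $\mathcal E_n(G)$.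 -/

import Mathlib

open CategoryTheory

universe u

/-! ### Pseudo-effect algebras -/

/-- A pseudo-effect algebra: a set with a partial binary operation `padd` (`padd a b` is defined iff
`(padd a b).Dom`, and `s ∈ padd a b` says that `a + b` exists and equals `s`) and two constants. -/
structure PseudoEffectAlgebra where
  carrier : Type u
  padd : carrier → carrier → Part carrier
  zero : carrier
  one : carrier
  /-- `a + b` and `(a + b) + c` exist iff `b + c` and `a + (b + c)` exist, with equal values. -/
  assoc : ∀ a b c d : carrier,
    (∃ s, s ∈ padd a b ∧ d ∈ padd s c) ↔ (∃ t, t ∈ padd b c ∧ d ∈ padd a t)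
  existsUnique_compl : ∀ a : carrier, (∃! d, one ∈ padd a d) ∧ (∃! e, one ∈ padd e a)
  conj : ∀ a b s : carrier, s ∈ padd a b → (∃ d, s ∈ padd d a) ∧ (∃ e, s ∈ padd b e)
  eq_zero : ∀ a : carrier, (padd a one).Dom ∨ (padd one a).Dom → a = zero

namespace PseudoEffectAlgebra

instance : CoeSort PseudoEffectAlgebra.{u} (Type u) := ⟨carrier⟩

/-- The natural order: `a ≤ b` iff `a + c = b` for some `c`. -/
def Le (E : PseudoEffectAlgebra.{u}) (a b : E) : Prop := ∃ c, b ∈ E.padd a c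

/-- `A⁻ = {x⁻ | x ∈ A}`, where `x⁻` is the element with `x⁻ + x = 1`. -/
def leftCompls (E : PseudoEffectAlgebra.{u}) (A : Set E) : Set E :=
  {y | ∃ x ∈ A, E.one ∈ E.padd y x}

/-- `A^∼ = {x^∼ | x ∈ A}`, where `x^∼` is the element with `x + x^∼ = 1`. -/
def rightCompls (E : PseudoEffectAlgebra.{u}) (A : Set E) : Set E :=
  {y | ∃ x ∈ A, E.one ∈ E.padd x y}

/-- The stronger Riesz decomposition property (RDP)₁ of a pseudo-effect algebra. -/
def RDP1 (E : PseudoEffectAlgebra.{u}) : Prop :=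
  ∀ a₁ a₂ b₁ b₂ s : E, s ∈ E.padd a₁ a₂ → s ∈ E.padd b₁ b₂ →
    ∃ c₁₁ c₁₂ c₂₁ c₂₂ : E,
      a₁ ∈ E.padd c₁₁ c₁₂ ∧ a₂ ∈ E.padd c₂₁ c₂₂ ∧ b₁ ∈ E.padd c₁₁ c₂₁ ∧ b₂ ∈ E.padd c₁₂ c₂₂ ∧
      ∀ x y : E, E.Le x c₁₂ → E.Le y c₂₁ → ∃ t, t ∈ E.padd x y ∧ t ∈ E.padd y x

/-- Ideals of a pseudo-effect algebra. -/
structure IsIdeal (E : PseudoEffectAlgebra.{u}) (I : Set E) : Prop where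
  nonempty : I.Nonempty
  down : ∀ a i : E, i ∈ I → E.Le a i → a ∈ I
  add_mem : ∀ i j s : E, i ∈ I → j ∈ I → s ∈ E.padd i j → s ∈ I

/-- Maximal ideals: proper ideals (`1 ∉ I`) not properly included in any proper ideal. -/
structure IsMaximalIdeal (E : PseudoEffectAlgebra.{u}) (I : Set E) : Prop where
  ideal : E.IsIdeal I
  proper : E.one ∉ I
  maximal : ∀ J : Set E, E.IsIdeal J → E.one ∉ J → I ⊆ J → J = I

/-- `n`-decompositions `(E₀, …, Eₙ)` of `E`; note that `Fin.rev i` is `n - i`. -/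
structure IsDecomposition (E : PseudoEffectAlgebra.{u}) (n : ℕ) (D : Fin (n + 1) → Set E) :
    Prop where
  nonempty : ∀ i, (D i).Nonempty
  disjoint : ∀ i j, i ≠ j → D i ∩ D j = ∅
  cover : ⋃ i, D i = Set.univ
  leftCompls_eq : ∀ i, E.leftCompls (D i) = D (Fin.rev i)
  rightCompls_eq : ∀ i, E.rightCompls (D i) = D (Fin.rev i)
  add_mem : ∀ (i j : Fin (n + 1)) (x y s : E), x ∈ D i → y ∈ D j → s ∈ E.padd x y →
    ∃ k : Fin (n + 1), (k : ℕ) = i + j ∧ s ∈ D k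

/-- `D = (E₀, …, Eₙ)` is an `n`-decomposition witnessing that `E` is `n`-perfect: `E_i + E_j` exists
whenever `i + j < n`, and `E₀` is the unique maximal ideal. -/
structure IsPerfectDecomposition (E : PseudoEffectAlgebra.{u}) (n : ℕ) (D : Fin (n + 1) → Set E) :
    Prop where
  decomposition : E.IsDecomposition n D
  add_dom : ∀ i j : Fin (n + 1), (i : ℕ) + j < n → ∀ x ∈ D i, ∀ y ∈ D j, (E.padd x y).Dom
  maximal : E.IsMaximalIdeal (D 0)
  unique : ∀ J : Set E, E.IsMaximalIdeal J → J = D 0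

/-- Homomorphisms of pseudo-effect algebras. -/
@[ext]
structure Hom (E F : PseudoEffectAlgebra.{u}) where
  toFun : E → F
  map_zero : toFun E.zero = F.zero
  map_one : toFun E.one = F.one
  map_padd : ∀ a b s : E, s ∈ E.padd a b → toFun s ∈ F.padd (toFun a) (toFun b)

/-- Isomorphisms of pseudo-effect algebras. -/
structure Iso (E F : PseudoEffectAlgebra.{u}) where
  toEquiv : E.carrier ≃ F.carrier
  map_zero : toEquiv E.zero = F.zero
  map_one : toEquiv E.one = F.one
  map_padd : ∀ a b s : E, s ∈ E.padd a b ↔ toEquiv s ∈ F.padd (toEquiv a) (toEquiv b)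

end PseudoEffectAlgebra

/-! ### Po-groups -/

/-- A po-group: a (not necessarily commutative) group, written additively, with a partial order
that is invariant under left and right translations. -/
structure PoGroup where
  carrier : Type u
  [addGroup : AddGroup carrier]
  [partialOrder : PartialOrder carrier]
  [addLeftMono : AddLeftMono carrier]
  [addRightMono : AddRightMono carrier]

namespace PoGroup

instance : CoeSort PoGroup.{u} (Type u) := ⟨carrier⟩

attribute [instance] addGroup partialOrder addLeftMono addRightMono

/-- No nonzero element has finite order. -/
def TorsionFree (G : PoGroup.{u}) : Prop := ∀ (g : G) (k : ℤ), g ≠ 0 → k ≠ 0 → k • g ≠ 0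

def Directed (G : PoGroup.{u}) : Prop := ∀ a b : G, ∃ c : G, a ≤ c ∧ b ≤ c

def IsStrongUnit (G : PoGroup.{u}) (e : G) : Prop := 0 ≤ e ∧ ∀ g : G, ∃ k : ℕ, 1 ≤ k ∧ g ≤ k • e

/-- (RDP)₁ of a po-group: the property (RDP)₁ for its positive cone. -/
def RDP1 (G : PoGroup.{u}) : Prop :=
  ∀ a₁ a₂ b₁ b₂ : G, 0 ≤ a₁ → 0 ≤ a₂ → 0 ≤ b₁ → 0 ≤ b₂ → a₁ + a₂ = b₁ + b₂ →
    ∃ c₁₁ c₁₂ c₂₁ c₂₂ : G, 0 ≤ c₁₁ ∧ 0 ≤ c₁₂ ∧ 0 ≤ c₂₁ ∧ 0 ≤ c₂₂ ∧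
      a₁ = c₁₁ + c₁₂ ∧ a₂ = c₂₁ + c₂₂ ∧ b₁ = c₁₁ + c₂₁ ∧ b₂ = c₁₂ + c₂₂ ∧
      ∀ x y : G, 0 ≤ x → x ≤ c₁₂ → 0 ≤ y → y ≤ c₂₁ → x + y = y + x

/-- The lexicographic product `ℤ ×⃗ G`. -/
noncomputable def lexInt (G : PoGroup.{u}) : PoGroup.{u} where
  carrier := ℤ ×ₗ G.carrier
  addLeftMono := ⟨fun a x y h => by
    rw [Prod.Lex.le_iff] at h ⊢
    rcases h with h | ⟨h, h'⟩
    · exact Or.inl (by simpa using h)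
    · exact Or.inr ⟨by simpa using h, by simpa using h'⟩⟩
  addRightMono := ⟨fun a x y h => by
    rw [Prod.Lex.le_iff] at h ⊢
    rcases h with h | ⟨h, h'⟩
    · exact Or.inl (by simpa [Function.swap] using h)
    · exact Or.inr ⟨by simpa [Function.swap] using h, by simpa [Function.swap] using h'⟩⟩

/-- The element `(i, g)` of `ℤ ×⃗ G`. -/
noncomputable def pair (G : PoGroup.{u}) (i : ℤ) (g : G) : G.lexInt := toLex (i, g)

/-- The pseudo-effect algebra `Γ(G, e) = {x | 0 ≤ x ≤ e}`, where `a + b` is defined iff `a ≤ e - b`,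
and then it is the sum in `G`. -/
def Gamma (G : PoGroup.{u}) (e : G) (he : 0 ≤ e) : PseudoEffectAlgebra.{u} where
  carrier := {x : G // 0 ≤ x ∧ x ≤ e}
  padd a b := ⟨a.1 ≤ e - b.1,
    fun h => ⟨a.1 + b.1, add_nonneg a.2.1 b.2.1, by simpa [le_sub_iff_add_le] using h⟩⟩
  zero := ⟨0, le_rfl, he⟩
  one := ⟨e, he, le_rfl⟩
  assoc a b c d := by
    constructor
    · rintro ⟨_, ⟨h₁, rfl⟩, h₂, rfl⟩
      have h₁' : a.1 + b.1 ≤ e := le_sub_iff_add_le.1 h₁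
      have h₂' : a.1 + b.1 + c.1 ≤ e := le_sub_iff_add_le.1 h₂
      refine ⟨_, ⟨le_sub_iff_add_le.2 ?_, rfl⟩, le_sub_iff_add_le.2 ?_, Subtype.ext ?_⟩
      · exact (le_add_of_nonneg_left a.2.1).trans (by simpa [add_assoc] using h₂')
      · simpa [add_assoc] using h₂'
      · simp [add_assoc]
    · rintro ⟨_, ⟨h₁, rfl⟩, h₂, rfl⟩
      have h₁' : b.1 + c.1 ≤ e := le_sub_iff_add_le.1 h₁
      have h₂' : a.1 + (b.1 + c.1) ≤ e := le_sub_iff_add_le.1 h₂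
      refine ⟨_, ⟨le_sub_iff_add_le.2 ?_, rfl⟩, le_sub_iff_add_le.2 ?_, Subtype.ext ?_⟩
      · refine (le_add_of_nonneg_right c.2.1).trans (by simpa [add_assoc] using h₂')
      · simpa [add_assoc] using h₂'
      · simp [add_assoc]
  existsUnique_compl a := by
    constructor
    · refine ⟨⟨-a.1 + e, ?_, ?_⟩, ⟨?_, Subtype.ext (by simp)⟩, ?_⟩
      · simpa [le_neg_add_iff_add_le] using a.2.2
      · simpa [neg_add_le_iff_le_add] using a.2.1
      · exact le_sub_iff_add_le.2 (by simp)
      · rintro d ⟨_, h⟩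
        have h' : a.1 + d.1 = e := congrArg Subtype.val h
        exact Subtype.ext (by simp [← h'])
    · refine ⟨⟨e - a.1, ?_, ?_⟩, ⟨?_, Subtype.ext (by simp)⟩, ?_⟩
      · simpa using a.2.2
      · simpa [sub_eq_add_neg] using a.2.1
      · exact le_sub_iff_add_le.2 (by simp)
      · rintro d ⟨_, h⟩
        have h' : d.1 + a.1 = e := congrArg Subtype.val h
        exact Subtype.ext (by simp [← h'])
  conj a b s := by
    rintro ⟨h, rfl⟩
    have h' : a.1 + b.1 ≤ e := le_sub_iff_add_le.1 h
    constructor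
    · have h₀ : 0 ≤ a.1 + b.1 - a.1 := sub_nonneg.2 (le_add_of_nonneg_right b.2.1)
      refine ⟨⟨a.1 + b.1 - a.1, h₀, ?_⟩, ?_, Subtype.ext (by simp)⟩
      · exact le_trans (by simpa [sub_eq_add_neg] using a.2.1) h'
      · exact le_sub_iff_add_le.2 (by simpa using h')
    · have h₀ : 0 ≤ -b.1 + (a.1 + b.1) := by
        simpa [le_neg_add_iff_add_le] using a.2.1
      refine ⟨⟨-b.1 + (a.1 + b.1), h₀, ?_⟩, ?_, Subtype.ext (by simp)⟩
      · exact le_trans (by simpa [neg_add_le_iff_le_add] using b.2.1) h'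
      · exact le_sub_iff_add_le.2 (by simpa using h')
  eq_zero a := by
    rintro (h | h)
    · have h' : a.1 ≤ e - e := h
      exact Subtype.ext (le_antisymm (by simpa using h') a.2.1)
    · have h' : e ≤ e - a.1 := h
      exact Subtype.ext (le_antisymm (by simpa [sub_eq_add_neg] using h') a.2.1)

theorem mem_padd_Gamma {G : PoGroup.{u}} {e : G} {he : 0 ≤ e} {a b s : G.Gamma e he} :
    s ∈ (G.Gamma e he).padd a b ↔ s.1 = a.1 + b.1 := by
  constructor
  · rintro ⟨_, rfl⟩
    rfl
  · intro h
    exact ⟨le_sub_iff_add_le.2 (h ▸ s.2.2), Subtype.ext h.symm⟩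

theorem le_Gamma_iff {G : PoGroup.{u}} {e : G} {he : 0 ≤ e} {a b : G.Gamma e he} :
    (G.Gamma e he).Le a b ↔ a.1 ≤ b.1 := by
  constructor
  · rintro ⟨c, hc⟩
    rw [mem_padd_Gamma.1 hc]
    exact le_add_of_nonneg_right c.2.1
  · intro h
    refine ⟨⟨-a.1 + b.1, ?_, ?_⟩, mem_padd_Gamma.2 (by simp)⟩
    · simpa [le_neg_add_iff_add_le] using h
    · exact le_trans (by simpa [neg_add_le_iff_le_add] using a.2.1) b.2.2

theorem pair_le_iff {G : PoGroup.{u}} {i j : ℤ} {g h : G} :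
    G.pair i g ≤ G.pair j h ↔ i < j ∨ i = j ∧ g ≤ h := Prod.Lex.toLex_le_toLex

theorem pair_add {G : PoGroup.{u}} (i j : ℤ) (g h : G) :
    G.pair i g + G.pair j h = G.pair (i + j) (g + h) := rfl

theorem pair_zero {G : PoGroup.{u}} : G.pair 0 0 = 0 := rfl

theorem nsmul_pair {G : PoGroup.{u}} (k : ℕ) (i : ℤ) (g : G) :
    k • G.pair i g = G.pair (k • i) (k • g) := rfl

theorem zsmul_pair {G : PoGroup.{u}} (k : ℤ) (i : ℤ) (g : G) :
    k • G.pair i g = G.pair (k • i) (k • g) := rfl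

theorem pair_inj {G : PoGroup.{u}} {i j : ℤ} {g h : G} :
    G.pair i g = G.pair j h ↔ i = j ∧ g = h := Prod.ext_iff

theorem pair_surj {G : PoGroup.{u}} (x : G.lexInt) : ∃ i g, x = G.pair i g := ⟨x.1, x.2, rfl⟩

theorem pair_nonneg {G : PoGroup.{u}} (n : ℕ) : (0 : G.lexInt) ≤ G.pair n 0 := by
  rw [← pair_zero, pair_le_iff]
  rcases Nat.eq_zero_or_pos n with rfl | h
  · exact Or.inr ⟨rfl, le_rfl⟩
  · exact Or.inl (by exact_mod_cast h)

/-- The pseudo-effect algebra `Γ(ℤ ×⃗ G, (n, 0))`. -/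
noncomputable def GammaLex (G : PoGroup.{u}) (n : ℕ) : PseudoEffectAlgebra.{u} :=
  G.lexInt.Gamma (G.pair n 0) (pair_nonneg n)

end PoGroup

/-! ### Strong `n`-perfect pseudo-effect algebras -/

/-- `E` is strong `n`-perfect: it is `n`-perfect with (RDP)₁, it can be identified with `Γ(H, e)` for
a torsion-free unital po-group `(H, e)`, and some `c ∈ E₁` satisfies `n c = e` and commutes with all
elements of `H`. -/
def PseudoEffectAlgebra.IsStrongPerfect (E : PseudoEffectAlgebra.{u}) (n : ℕ) : Prop :=
  E.RDP1 ∧ ∃ D : Fin (n + 1) → Set E, E.IsPerfectDecomposition n D ∧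
    ∃ (H : PoGroup.{u}) (e : H) (he : H.IsStrongUnit e) (φ : E.Iso (H.Gamma e he.1)),
      H.TorsionFree ∧
      ∃ (i : Fin (n + 1)) (c : E), (i : ℕ) = 1 ∧ c ∈ D i ∧
        n • (φ.toEquiv c).1 = e ∧ ∀ x : H, x + (φ.toEquiv c).1 = (φ.toEquiv c).1 + x

namespace PoGroup

variable {G : PoGroup.{u}}

theorem isStrongUnit_pair {n : ℕ} (hn : 1 ≤ n) : G.lexInt.IsStrongUnit (G.pair n 0) := by
  refine ⟨pair_nonneg n, fun x => ?_⟩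
  obtain ⟨i, g, rfl⟩ := pair_surj x
  refine ⟨i.toNat + 1, by omega, ?_⟩
  rw [nsmul_pair, pair_le_iff]
  left
  have h1 : i ≤ i.toNat := Int.self_le_toNat i
  have h2 : (1 : ℤ) ≤ n := by exact_mod_cast hn
  simp only [nsmul_eq_mul]
  push_cast
  nlinarith

theorem torsionFree_lexInt (h : G.TorsionFree) : G.lexInt.TorsionFree := by
  intro x k hx hk h0
  obtain ⟨i, g, rfl⟩ := pair_surj x
  rw [zsmul_pair, ← pair_zero, pair_inj] at h0
  rw [← pair_zero, Ne, pair_inj] at hx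
  have hi : i = 0 := by simpa [hk] using h0.1
  exact h g k (fun hg => hx ⟨hi, hg⟩) hk h0.2

theorem RDP1.gamma {H : PoGroup.{u}} (h : H.RDP1) (e : H) (he : 0 ≤ e) :
    (H.Gamma e he).RDP1 := by
  intro a₁ a₂ b₁ b₂ s ha hb
  rw [mem_padd_Gamma] at ha hb
  obtain ⟨c₁₁, c₁₂, c₂₁, c₂₂, p₁₁, p₁₂, p₂₁, p₂₂, ea₁, ea₂, eb₁, eb₂, hc⟩ :=
    h a₁.1 a₂.1 b₁.1 b₂.1 a₁.2.1 a₂.2.1 b₁.2.1 b₂.2.1 (ha.symm.trans hb)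
  have l₁₁ : c₁₁ ≤ e := le_trans (by rw [ea₁]; exact le_add_of_nonneg_right p₁₂) a₁.2.2
  have l₁₂ : c₁₂ ≤ e := le_trans (by rw [ea₁]; exact le_add_of_nonneg_left p₁₁) a₁.2.2
  have l₂₁ : c₂₁ ≤ e := le_trans (by rw [ea₂]; exact le_add_of_nonneg_right p₂₂) a₂.2.2
  have l₂₂ : c₂₂ ≤ e := le_trans (by rw [ea₂]; exact le_add_of_nonneg_left p₂₁) a₂.2.2
  refine ⟨⟨c₁₁, p₁₁, l₁₁⟩, ⟨c₁₂, p₁₂, l₁₂⟩, ⟨c₂₁, p₂₁, l₂₁⟩, ⟨c₂₂, p₂₂, l₂₂⟩,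
    mem_padd_Gamma.2 ea₁, mem_padd_Gamma.2 ea₂, mem_padd_Gamma.2 eb₁, mem_padd_Gamma.2 eb₂, ?_⟩
  intro x y hx hy
  replace hx : x.1 ≤ c₁₂ := le_Gamma_iff.1 hx
  replace hy : y.1 ≤ c₂₁ := le_Gamma_iff.1 hy
  have hxy := hc x.1 y.1 x.2.1 hx y.2.1 hy
  have hle : x.1 + y.1 ≤ e := by
    refine le_trans ?_ s.2.2
    rw [ha]
    refine add_le_add (hx.trans ?_) (hy.trans ?_)
    · rw [ea₁]; exact le_add_of_nonneg_left p₁₁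
    · rw [ea₂]; exact le_add_of_nonneg_right p₂₂
  exact ⟨⟨x.1 + y.1, add_nonneg x.2.1 y.2.1, hle⟩, mem_padd_Gamma.2 rfl, mem_padd_Gamma.2 hxy⟩

/-- The slices `{(i, g)}` of `Γ(ℤ ×⃗ G, (n, 0))`. -/
def slices (G : PoGroup.{u}) (n : ℕ) (i : Fin (n + 1)) : Set (G.GammaLex n) :=
  {x | (ofLex x.1).1 = (i : ℕ)}

theorem GammaLex_cases {n : ℕ} (x : G.GammaLex n) :
    ∃ i : ℕ, ∃ g : G, i ≤ n ∧ x.1 = G.pair i g ∧ (i = 0 → 0 ≤ g) ∧ (i = n → g ≤ 0) := by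
  obtain ⟨i, g, hx⟩ := pair_surj x.1
  have h0 := x.2.1
  have h1 := x.2.2
  rw [hx, ← pair_zero, pair_le_iff] at h0
  rw [hx, pair_le_iff] at h1
  lift i to ℕ using (by omega)
  refine ⟨i, g, by omega, hx, ?_, ?_⟩
  · rintro rfl
    simpa using h0
  · rintro rfl
    simpa using h1

theorem mk_mem {n : ℕ} (i : ℕ) (g : G) (hi : i ≤ n) (h0 : i = 0 → 0 ≤ g) (h1 : i = n → g ≤ 0) :
    0 ≤ G.pair i g ∧ G.pair i g ≤ G.pair n 0 := by
  rw [← pair_zero, pair_le_iff, pair_le_iff]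
  constructor
  · rcases Nat.eq_zero_or_pos i with rfl | h
    · exact Or.inr ⟨rfl, h0 rfl⟩
    · exact Or.inl (by exact_mod_cast h)
  · rcases hi.eq_or_lt with rfl | h
    · exact Or.inr ⟨rfl, h1 rfl⟩
    · exact Or.inl (by exact_mod_cast h)

theorem isDecomposition_slices (G : PoGroup.{u}) (n : ℕ) :
    (G.GammaLex n).IsDecomposition n (G.slices n) where
  nonempty i := ⟨⟨G.pair (i : ℕ) 0, mk_mem _ _ (by omega) (by simp) (by simp)⟩, rfl⟩
  disjoint i j hij := by
    ext x
    simp only [Set.mem_inter_iff, Set.mem_empty_iff_false, iff_false, not_and]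
    intro h1 h2
    have h1' : (ofLex x.1).1 = (i : ℕ) := h1
    have h2' : (ofLex x.1).1 = (j : ℕ) := h2
    exact hij (Fin.ext (by omega))
  cover := by
    ext x
    simp only [Set.mem_iUnion, Set.mem_univ, iff_true]
    obtain ⟨i, g, hi, hx, -, -⟩ := GammaLex_cases x
    refine ⟨⟨i, by omega⟩, ?_⟩
    change (ofLex x.1).1 = _
    rw [hx]
    rfl
  leftCompls_eq i := by
    ext y
    constructor
    · rintro ⟨x, hx, h⟩
      have hx' : (ofLex x.1).1 = (i : ℕ) := hx
      have h' := congrArg (fun z => (ofLex z).1) (mem_padd_Gamma.1 h)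
      have h'' : (n : ℤ) = (ofLex y.1).1 + (ofLex x.1).1 := h'
      change (ofLex y.1).1 = _
      rw [Fin.val_rev]
      omega
    · intro hy
      have hy' : (ofLex y.1).1 = ((Fin.rev i : Fin (n + 1)) : ℕ) := hy
      obtain ⟨x, h, -⟩ := ((G.GammaLex n).existsUnique_compl y).1
      refine ⟨x, ?_, h⟩
      have h' := congrArg (fun z => (ofLex z).1) (mem_padd_Gamma.1 h)
      have h'' : (n : ℤ) = (ofLex y.1).1 + (ofLex x.1).1 := h'
      change (ofLex x.1).1 = _
      rw [Fin.val_rev] at hy'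
      omega
  rightCompls_eq i := by
    ext y
    constructor
    · rintro ⟨x, hx, h⟩
      have hx' : (ofLex x.1).1 = (i : ℕ) := hx
      have h' := congrArg (fun z => (ofLex z).1) (mem_padd_Gamma.1 h)
      have h'' : (n : ℤ) = (ofLex x.1).1 + (ofLex y.1).1 := h'
      change (ofLex y.1).1 = _
      rw [Fin.val_rev]
      omega
    · intro hy
      have hy' : (ofLex y.1).1 = ((Fin.rev i : Fin (n + 1)) : ℕ) := hy
      obtain ⟨x, h, -⟩ := ((G.GammaLex n).existsUnique_compl y).2
      refine ⟨x, ?_, h⟩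
      have h' := congrArg (fun z => (ofLex z).1) (mem_padd_Gamma.1 h)
      have h'' : (n : ℤ) = (ofLex x.1).1 + (ofLex y.1).1 := h'
      change (ofLex x.1).1 = _
      rw [Fin.val_rev] at hy'
      omega
  add_mem i j x y s hx hy h := by
    have hx' : (ofLex x.1).1 = (i : ℕ) := hx
    have hy' : (ofLex y.1).1 = (j : ℕ) := hy
    have h' := congrArg (fun z => (ofLex z).1) (mem_padd_Gamma.1 h)
    have h'' : (ofLex s.1).1 = (ofLex x.1).1 + (ofLex y.1).1 := h'
    obtain ⟨k, g, hk, hs, -, -⟩ := GammaLex_cases s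
    have hs' : (ofLex s.1).1 = (k : ℕ) := by rw [hs]; rfl
    exact ⟨⟨k, by omega⟩, by simp only; omega, hs'⟩

theorem mem_ideal_of_le {n : ℕ} {J : Set (G.GammaLex n)} (hJ : (G.GammaLex n).IsIdeal J)
    {a b : G.GammaLex n} (hb : b ∈ J) (h : a.1 ≤ b.1) : a ∈ J :=
  hJ.down a b hb (le_Gamma_iff.2 h)

theorem mem_ideal_of_add {n : ℕ} {J : Set (G.GammaLex n)} (hJ : (G.GammaLex n).IsIdeal J)
    {a b s : G.GammaLex n} (ha : a ∈ J) (hb : b ∈ J) (h : s.1 = a.1 + b.1) : s ∈ J :=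
  hJ.add_mem a b s ha hb (mem_padd_Gamma.2 h)

theorem isIdeal_slice_zero (G : PoGroup.{u}) (n : ℕ) :
    (G.GammaLex n).IsIdeal (G.slices n 0) where
  nonempty := (G.isDecomposition_slices n).nonempty 0
  down a i hi h := by
    obtain ⟨k, g, hk, ha, -, -⟩ := GammaLex_cases a
    obtain ⟨l, g', hl, hi', -, -⟩ := GammaLex_cases i
    have h1 : (ofLex i.1).1 = (0 : ℕ) := hi
    have h2 := le_Gamma_iff.1 h
    rw [ha, hi', pair_le_iff] at h2
    rw [hi'] at h1
    have h1' : (l : ℤ) = (0 : ℕ) := h1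
    change (ofLex a.1).1 = (0 : ℕ)
    rw [ha]
    change (k : ℤ) = (0 : ℕ)
    omega
  add_mem i j s hi hj h := by
    obtain ⟨k, hk, hs⟩ := (G.isDecomposition_slices n).add_mem 0 0 i j s hi hj h
    have : k = 0 := Fin.ext (by simpa using hk)
    exact this ▸ hs

/-- Every proper ideal is contained in the zero slice. -/
theorem subset_slice_zero (hG : G.Directed) {n : ℕ} (hn : 1 ≤ n) {J : Set (G.GammaLex n)}
    (hJ : (G.GammaLex n).IsIdeal J) (h1 : (G.GammaLex n).one ∉ J) : J ⊆ G.slices n 0 := by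
  intro x hx
  by_contra hx0
  apply h1
  obtain ⟨i, g, hi, hxe, hg0, hgn⟩ := GammaLex_cases x
  have hi0 : 1 ≤ i := by
    by_contra hlt
    apply hx0
    change (ofLex x.1).1 = _
    rw [hxe]
    change (i : ℤ) = (0 : ℕ)
    omega
  -- all elements of the zero slice lie in `J`
  have hz : ∀ h : G, ∀ hh : 0 ≤ h, (⟨G.pair (0 : ℕ) h, mk_mem 0 h (by omega) (fun _ => hh)
      (by omega)⟩ : G.GammaLex n) ∈ J := by
    intro h hh
    refine mem_ideal_of_le hJ hx ?_
    rw [hxe]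
    exact pair_le_iff.2 (Or.inl (by exact_mod_cast hi0))
  -- `(1, 0)` lies in `J`
  have hone : (⟨G.pair (1 : ℕ) 0, mk_mem 1 0 hn (by simp) (by simp)⟩ : G.GammaLex n) ∈ J := by
    obtain ⟨c, hgc, hc0⟩ := hG (-g) 0
    have hcg : -c ≤ g := by simpa using neg_le_neg_iff.2 hgc
    have hmem : (⟨G.pair (1 : ℕ) (-c), mk_mem 1 (-c) hn (by simp)
        (by simpa using fun _ => hc0)⟩ : G.GammaLex n) ∈ J := by
      refine mem_ideal_of_le hJ hx ?_
      rw [hxe, pair_le_iff]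
      rcases hi0.eq_or_lt with rfl | h
      · exact Or.inr ⟨rfl, hcg⟩
      · exact Or.inl (by exact_mod_cast h)
    refine mem_ideal_of_add hJ hmem (hz c hc0) ?_
    change G.pair _ _ = G.pair _ _ + G.pair _ _
    rw [pair_add, pair_inj]
    simp
  have hall : ∀ k : ℕ, ∀ hk : k ≤ n,
      (⟨G.pair k 0, mk_mem k 0 hk (by simp) (by simp)⟩ : G.GammaLex n) ∈ J := by
    intro k
    induction k with
    | zero => exact fun _ => hz 0 le_rfl
    | succ k ih =>
      intro hk
      refine mem_ideal_of_add hJ (ih (by omega)) hone ?_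
      change G.pair _ _ = G.pair _ _ + G.pair _ _
      rw [pair_add, pair_inj]
      simp
  exact hall n le_rfl

theorem isPerfectDecomposition_slices (hG : G.Directed) {n : ℕ} (hn : 1 ≤ n) :
    (G.GammaLex n).IsPerfectDecomposition n (G.slices n) := by
  have h1 : (G.GammaLex n).one ∉ G.slices n 0 := by
    intro h
    have h' : (n : ℤ) = (0 : ℕ) := h
    omega
  have hmax : (G.GammaLex n).IsMaximalIdeal (G.slices n 0) :=
    ⟨G.isIdeal_slice_zero n, h1, fun J hJ hJ1 hle =>
      Set.Subset.antisymm (subset_slice_zero hG hn hJ hJ1) hle⟩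
  refine ⟨G.isDecomposition_slices n, ?_, hmax, ?_⟩
  · intro i j hij x hx y hy
    obtain ⟨k, g, hk, hxe, -, -⟩ := GammaLex_cases x
    obtain ⟨l, h, hl, hye, -, -⟩ := GammaLex_cases y
    have hx' : (ofLex x.1).1 = (i : ℕ) := hx
    have hy' : (ofLex y.1).1 = (j : ℕ) := hy
    rw [hxe] at hx'
    rw [hye] at hy'
    have hx'' : (k : ℤ) = (i : ℕ) := hx'
    have hy'' : (l : ℤ) = (j : ℕ) := hy'
    change x.1 ≤ G.pair n 0 - y.1
    rw [le_sub_iff_add_le, hxe, hye, pair_add, pair_le_iff]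
    left
    omega
  · intro J hJ
    exact (hJ.maximal _ (G.isIdeal_slice_zero n) h1
      (subset_slice_zero hG hn hJ.ideal hJ.proper)).symm

theorem isStrongPerfect_GammaLex (hG : G.Directed) (ht : G.TorsionFree) (hr : G.lexInt.RDP1)
    {n : ℕ} (hn : 1 ≤ n) : (G.GammaLex n).IsStrongPerfect n := by
  refine ⟨hr.gamma _ _, G.slices n, isPerfectDecomposition_slices hG hn, G.lexInt, G.pair n 0,
    isStrongUnit_pair hn, ⟨Equiv.refl _, rfl, rfl, fun _ _ _ => Iff.rfl⟩,
    torsionFree_lexInt ht, ⟨1, by omega⟩,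
    ⟨G.pair (1 : ℕ) 0, mk_mem 1 0 hn (by simp) (by simp)⟩, rfl, rfl, ?_, ?_⟩
  · change n • G.pair _ _ = _
    rw [nsmul_pair, pair_inj]
    simp
  · intro x
    obtain ⟨i, g, rfl⟩ := pair_surj x
    change G.pair _ _ + G.pair _ _ = G.pair _ _ + G.pair _ _
    rw [pair_add, pair_add, pair_inj]
    exact ⟨add_comm _ _, by simp⟩

end PoGroup

/-! ### The categories and the functor -/

/-- The category of torsion-free directed po-groups `G` such that `ℤ ×⃗ G` has (RDP)₁, with
po-group homomorphisms (order-preserving group homomorphisms). -/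
structure TFPoGroupCat where
  obj : PoGroup.{u}
  torsionFree : obj.TorsionFree
  directed : obj.Directed
  rdp1 : obj.lexInt.RDP1

instance : Category.{u} TFPoGroupCat.{u} where
  Hom G H := G.obj →+o H.obj
  id G := OrderAddMonoidHom.id G.obj
  comp f g := g.comp f

/-- The category of strong `n`-perfect pseudo-effect algebras with their homomorphisms. -/
structure StrongPerfectPEACat (n : ℕ) where
  obj : PseudoEffectAlgebra.{u}
  strongPerfect : obj.IsStrongPerfect n

instance (n : ℕ) : Category.{u} (StrongPerfectPEACat.{u} n) where
  Hom E F := E.obj.Hom F.obj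
  id E := ⟨id, rfl, rfl, fun _ _ _ h => h⟩
  comp f g := ⟨g.toFun ∘ f.toFun, by simp [f.map_zero, g.map_zero], by simp [f.map_one, g.map_one],
    fun _ _ _ h => g.map_padd _ _ _ (f.map_padd _ _ _ h)⟩

theorem PoGroup.map_mem {G H : PoGroup.{u}} (f : G →+o H) {n : ℕ} (x : G.GammaLex n) :
    0 ≤ H.pair (ofLex x.1).1 (f (ofLex x.1).2) ∧
      H.pair (ofLex x.1).1 (f (ofLex x.1).2) ≤ H.pair n 0 := by
  obtain ⟨i, g, hi, hx, h0, h1⟩ := GammaLex_cases x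
  rw [hx]
  exact mk_mem i (f g) hi (fun h => by simpa using f.monotone' (h0 h))
    (fun h => by simpa using f.monotone' (h1 h))

/-- The homomorphism `Γ(ℤ ×⃗ G, (n, 0)) → Γ(ℤ ×⃗ H, (n, 0))`, `(i, g) ↦ (i, f g)`. -/
noncomputable def PoGroup.GammaLexMap {G H : PoGroup.{u}} (f : G →+o H) (n : ℕ) :
    (G.GammaLex n).Hom (H.GammaLex n) where
  toFun x := ⟨H.pair (ofLex x.1).1 (f (ofLex x.1).2), map_mem f x⟩
  map_zero := Subtype.ext (pair_inj.2 ⟨rfl, map_zero f⟩)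
  map_one := Subtype.ext (pair_inj.2 ⟨rfl, map_zero f⟩)
  map_padd a b s h := by
    have h' := mem_padd_Gamma.1 h
    refine mem_padd_Gamma.2 ?_
    change H.pair _ _ = H.pair _ _ + H.pair _ _
    rw [pair_add, pair_inj, h']
    exact ⟨rfl, map_add f _ _⟩

/-- The functor `𝓔ₙ`, `G ↦ Γ(ℤ ×⃗ G, (n, 0))`. -/
noncomputable def functorE (n : ℕ) (hn : 1 ≤ n) :
    TFPoGroupCat.{u} ⥤ StrongPerfectPEACat.{u} n where
  obj G := ⟨G.obj.GammaLex n, PoGroup.isStrongPerfect_GammaLex G.directed G.torsionFree G.rdp1 hn⟩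
  map f := PoGroup.GammaLexMap f n
  map_id _ := rfl
  map_comp _ _ := rfl

/-! ### Directed po-groups as groups of differences of positive elements. -/

namespace PoGroup

variable {G H : PoGroup.{u}}

/-! Call the elements of degree 0 infinitesimal. The infinitesimals of `Γ(ℤ ×⃗ G, (n, 0))` are the
pairs `(0, g)` with `g ≥ 0`, that is, a copy of the positive cone of `G`. As `G` is directed, it is
the group of differences of this cone, so the infinitesimals determine `G` and its homomorphisms.

Faithfulness is immediate from this. For fullness, a homomorphism `φ` keeps infinitesimals
infinitesimal, since all multiples of `(0, g)` exist while degrees are bounded by `n`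
(`deg_map_infinitesimal`); it fixes every `(i, 0)`, since `n` times the image of `(1, 0)` is `(n,
0)` and the target is torsion-free (`map_cyc`). Its restriction to infinitesimals extends to a group
homomorphism (`exists_extension`), which then gives `φ` back in every degree.

For essential surjectivity, let `E` be the interval `[0, nc]` in `H` with `c` central. The image of
`E₀` is the cone of a directed torsion-free po-group `G₀` of differences inside `H`. The crux is
that `E₁` lies in the coset `c + G₀` (`exists_eq_cyc_add`). For `y ∈ E₁`, (RDP)₁ turns the sums of
elements below `y` into an ideal; it is not contained in `E₀`, the only maximal ideal, so by Zorn's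
lemma it contains `1`, hence everything, in particular `c`. In a sum of degree 1 exactly one summand
is not infinitesimal, so `c` differs from `y` by elements of `G₀`. Since lower slices lie below
higher ones, the elements of degree `k` are then exactly the admissible `kc + g` with `g ∈ G₀`, and
`(k, g) ↦ kc + g` is an isomorphism (`exists_iso`).

Finally `G₀` inherits (RDP)₁ from `E` (`rdp1_infGroup`), and (RDP)₁ passes from a directed group to
its lexicographic product with `ℤ` (`RDP1.lexInt`). -/

theorem Directed.exists_sub (hG : G.Directed) (g : G) :
    ∃ a b : G, 0 ≤ a ∧ 0 ≤ b ∧ g = a - b := by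
  obtain ⟨a, hga, ha⟩ := hG g 0
  refine ⟨a, -g + a, ha, by simpa [le_neg_add_iff_add_le] using hga, ?_⟩
  simp [sub_eq_add_neg, neg_add_rev]

/-- A map that is additive on the positive cone of a directed po-group extends to the group. -/
theorem Directed.exists_extension (hG : G.Directed) {K : Type*} [AddGroup K] (f : G → K)
    (hf : ∀ a b : G, 0 ≤ a → 0 ≤ b → f (a + b) = f a + f b) :
    ∃ F : G →+ K, ∀ a b : G, 0 ≤ a → 0 ≤ b → F (a - b) = f a - f b := by
  choose p q hp hq hpq using hG.exists_sub
  have wd : ∀ a b a' b' : G, 0 ≤ a → 0 ≤ b → 0 ≤ a' → 0 ≤ b' → a - b = a' - b' →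
      f a - f b = f a' - f b' := by
    intro a b a' b' ha hb ha' hb' h
    -- A common right denominator: with `s - t = -a' + a`, adding `t` to `a`, `b` and `s` to `a'`,
    -- `b'` on the right gives equal positive elements, to which additivity of `f` applies.
    obtain ⟨s, t, hs, ht, hst⟩ := hG.exists_sub (-a' + a)
    have h1 : a + t = a' + s := by
      have : a = a' + (s - t) := by rw [← hst]; simp
      rw [this]; simp [add_assoc]
    have h2 : b + t = b' + s := by
      have e1 : b = b' - a' + a := by
        have : -b = -a + a' - b' := by rw [add_sub_assoc, ← h]; simp [sub_eq_add_neg]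
        rw [← neg_neg b, this]; simp [sub_eq_add_neg, neg_add_rev, add_assoc]
      rw [e1, add_assoc, h1]; simp [sub_eq_add_neg, add_assoc]
    have k1 := hf a t ha ht
    rw [h1, hf a' s ha' hs] at k1
    have k2 := hf b t hb ht
    rw [h2, hf b' s hb' hs] at k2
    calc f a - f b = (f a + f t) - (f b + f t) := by simp
      _ = f a' - f b' := by rw [← k1, ← k2]; simp
  refine ⟨⟨⟨fun g => f (p g) - f (q g), ?_⟩, ?_⟩, ?_⟩
  · simp only [wd (p 0) (q 0) 0 0 (hp 0) (hq 0) le_rfl le_rfl (by rw [← hpq]; simp), sub_self]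
  · intro x y
    -- Rewriting the inner difference `-q x + p y` as `s - t` turns `x + y` into the single
    -- difference `(p x + s) - (q y + t)`; the same rewriting is valid after applying `f`.
    obtain ⟨s, t, hs, ht, hst⟩ := hG.exists_sub (-q x + p y)
    have h1 : p y + t = q x + s := by
      have : p y = q x + (s - t) := by rw [← hst]; simp
      rw [this]; simp [add_assoc]
    have k1 := hf _ _ (hp y) ht
    rw [h1, hf _ _ (hq x) hs] at k1
    have k2 : -f (q x) + f (p y) = f s - f t := by
      have : f (p y) = f (q x) + f s - f t := by rw [k1]; simp
      rw [this, add_sub_assoc]; simp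
    have h3 : p (x + y) - q (x + y) = (p x + s) - (q y + t) := by
      rw [← hpq (x + y)]
      conv_lhs => rw [hpq x, hpq y]
      calc p x - q x + (p y - q y) = p x + (-q x + p y) - q y := by
            simp only [sub_eq_add_neg, add_assoc]
        _ = _ := by rw [hst]; simp only [sub_eq_add_neg, add_assoc, neg_add_rev]
    have k3 := wd _ _ _ _ (hp (x + y)) (hq (x + y)) (add_nonneg (hp x) hs)
      (add_nonneg (hq y) ht) h3
    change f (p (x + y)) - f (q (x + y)) = f (p x) - f (q x) + (f (p y) - f (q y))
    rw [k3, hf _ _ (hp x) hs, hf _ _ (hq y) ht]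
    calc f (p x) + f s - (f (q y) + f t) = f (p x) + (f s - f t) - f (q y) := by
            simp only [sub_eq_add_neg, add_assoc, neg_add_rev]
      _ = _ := by rw [← k2]; simp only [sub_eq_add_neg, add_assoc]
  · intro a b ha hb
    exact wd _ _ _ _ (hp _) (hq _) ha hb (hpq _).symm

/-! ### (RDP)₁ for the lexicographic product. -/

theorem pair_nonneg_iff {i : ℤ} {g : G} : 0 ≤ G.pair i g ↔ 0 < i ∨ i = 0 ∧ 0 ≤ g := by
  rw [← pair_zero, pair_le_iff, eq_comm]

theorem mem_interval_pair_zero {x : G.lexInt} {c : G} (h0 : 0 ≤ x) (h : x ≤ G.pair 0 c) :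
    ∃ g, x = G.pair 0 g ∧ 0 ≤ g ∧ g ≤ c := by
  obtain ⟨i, g, rfl⟩ := pair_surj x
  rw [pair_nonneg_iff] at h0
  rw [pair_le_iff] at h
  obtain rfl : i = 0 := by omega
  exact ⟨g, rfl, by simpa using h0, by simpa using h⟩

/-- A directed po-group with (RDP)₁ has a lexicographic product with `ℤ` satisfying (RDP)₁. -/
theorem RDP1.lexInt (hG : G.Directed) (hr : G.RDP1) : G.lexInt.RDP1 := by
  intro a₁ a₂ b₁ b₂ ha₁ ha₂ hb₁ hb₂ hab
  obtain ⟨α, g₁, rfl⟩ := pair_surj a₁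
  obtain ⟨α', g₂, rfl⟩ := pair_surj a₂
  obtain ⟨β, h₁, rfl⟩ := pair_surj b₁
  obtain ⟨β', h₂, rfl⟩ := pair_surj b₂
  rw [pair_add, pair_add, pair_inj] at hab
  obtain ⟨hd, hg⟩ := hab
  rcases lt_trichotomy α β with hlt | rfl | hlt
  -- For different integer parts the smaller first summand is itself the corner `c₁₁`. One
  -- off-diagonal entry is then `0`, so the commutation condition is trivial.
  · refine ⟨G.pair α g₁, 0, G.pair (β - α) (-g₁ + h₁), G.pair β' h₂, ha₁, le_rfl, ?_, hb₂,
      (add_zero _).symm, ?_, ?_, (zero_add _).symm, ?_⟩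
    · rw [pair_nonneg_iff]; left; omega
    · rw [pair_add, pair_inj, add_assoc, ← hg]
      exact ⟨by omega, by simp⟩
    · rw [pair_add, pair_inj]
      exact ⟨by omega, by simp⟩
    · intro x y hx hx' _ _
      simp [le_antisymm hx' hx]
  · obtain rfl : α' = β' := by omega
    rw [pair_nonneg_iff] at ha₁ ha₂ hb₁ hb₂
    -- The off-diagonal entries are sought in degree 0, as `(0, p)` and `(0, q)`. The diagonal
    -- entries have degrees `α` and `α'`, so their `G`-parts need to be positive only where that
    -- degree is 0.
    suffices h : ∃ p q : G, 0 ≤ p ∧ 0 ≤ q ∧ g₁ - p + q = h₁ ∧ (α = 0 → 0 ≤ g₁ - p) ∧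
        (α' = 0 → 0 ≤ -q + g₂) ∧ ∀ x y : G, 0 ≤ x → x ≤ p → 0 ≤ y → y ≤ q → x + y = y + x by
      obtain ⟨p, q, hp, hq, hpq, h₃, h₄, hc⟩ := h
      have hcomm := hc p q hp le_rfl hq le_rfl
      refine ⟨G.pair α (g₁ - p), G.pair 0 p, G.pair 0 q, G.pair α' (-q + g₂),
        pair_nonneg_iff.2 ?_, pair_nonneg_iff.2 (by simp [hp]), pair_nonneg_iff.2 (by simp [hq]),
        pair_nonneg_iff.2 ?_, ?_, ?_, ?_, ?_, ?_⟩
      · rcases ha₁ with h | h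
        · exact Or.inl h
        · exact Or.inr ⟨h.1, h₃ h.1⟩
      · rcases ha₂ with h | h
        · exact Or.inl h
        · exact Or.inr ⟨h.1, h₄ h.1⟩
      · simp [pair_add]
      · simp [pair_add]
      · simp [pair_add, hpq]
      · rw [pair_add, pair_inj]
        refine ⟨by simp, ?_⟩
        have e1 : h₁ + h₂ = h₁ + (p + (-q + g₂)) := by
          rw [← hg, ← hpq]
          have : q + (p + (-q + g₂)) = p + g₂ := by
            rw [← add_assoc, ← hcomm]; simp [add_assoc]
          rw [add_assoc, this]; simp [sub_eq_add_neg, add_assoc]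
        exact add_left_cancel e1
      · intro x y hx hx' hy hy'
        obtain ⟨x, rfl, hx, hx'⟩ := mem_interval_pair_zero hx hx'
        obtain ⟨y, rfl, hy, hy'⟩ := mem_interval_pair_zero hy hy'
        rw [pair_add, pair_add, hc x y hx hx' hy hy']
    by_cases hα : α = 0
    · have hg₁ : 0 ≤ g₁ := by simpa [hα] using ha₁
      have hh₁ : 0 ≤ h₁ := by simpa [hα] using hb₁
      by_cases hα' : α' = 0
      · have hg₂ : 0 ≤ g₂ := by simpa [hα'] using ha₂
        have hh₂ : 0 ≤ h₂ := by simpa [hα'] using hb₂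
        obtain ⟨c₁₁, c₁₂, c₂₁, c₂₂, p₁₁, p₁₂, p₂₁, p₂₂, ea₁, ea₂, eb₁, eb₂, hc⟩ :=
          hr g₁ g₂ h₁ h₂ hg₁ hg₂ hh₁ hh₂ hg
        exact ⟨c₁₂, c₂₁, p₁₂, p₂₁, by simp [ea₁, eb₁], by simp [ea₁, p₁₁], by simp [ea₂, p₂₂], hc⟩
      -- Only `c₁₁` is constrained here. Refining `g₁ + (-g₁ + h₁ + g₁) = h₁ + g₁` splits off a
      -- common left part of `g₁` and `h₁`, with remainders that commute.
      · obtain ⟨c₁₁, c₁₂, c₂₁, c₂₂, p₁₁, p₁₂, p₂₁, p₂₂, ea₁, ea₂, eb₁, eb₂, hc⟩ :=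
          hr g₁ (-g₁ + h₁ + g₁) h₁ g₁ hg₁
            (by rw [add_assoc, le_neg_add_iff_add_le, add_zero]; exact le_add_of_nonneg_left hh₁)
            hh₁ hg₁ (by simp [add_assoc])
        exact ⟨c₁₂, c₂₁, p₁₂, p₂₁, by rw [ea₁, eb₁]; simp, by rw [ea₁]; simp [p₁₁],
          fun h => absurd h hα', hc⟩
    · by_cases hα' : α' = 0
      · have hg₂ : 0 ≤ g₂ := by simpa [hα'] using ha₂
        have hh₂ : 0 ≤ h₂ := by simpa [hα'] using hb₂
        -- The mirror image: `c₂₂` becomes a common right part of `g₂` and `h₂`.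
        obtain ⟨c₁₁, c₁₂, c₂₁, c₂₂, p₁₁, p₁₂, p₂₁, p₂₂, ea₁, ea₂, eb₁, eb₂, hc⟩ :=
          hr h₂ g₂ (h₂ + g₂ - h₂) h₂ hh₂ hg₂
            (sub_nonneg.2 (le_add_of_nonneg_right hg₂)) hh₂ (by simp)
        refine ⟨c₁₂, c₂₁, p₁₂, p₂₁, ?_, fun h => absurd h hα, fun _ => by rw [ea₂]; simp [p₂₂], hc⟩
        have hcomm := hc _ _ p₁₂ le_rfl p₂₁ le_rfl
        have e1 : h₁ + h₂ = g₁ - c₁₂ + c₂₁ + h₂ := by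
          rw [← hg, ea₂, eb₂, add_assoc (g₁ - c₁₂), ← add_assoc c₂₁, ← hcomm]
          simp [sub_eq_add_neg, add_assoc]
        exact (add_right_cancel e1).symm
      -- No corner is constrained, but commutation is still required. Removing a common right part
      -- of `b` and `a` rewrites `b - a` as `c₁₂ - c₂₁` with commuting intervals below the two
      -- entries.
      · obtain ⟨b, a, hb, ha, hd'⟩ := hG.exists_sub (-h₁ + g₁)
        obtain ⟨c₁₁, c₁₂, c₂₁, c₂₂, p₁₁, p₁₂, p₂₁, p₂₂, ea₁, ea₂, eb₁, eb₂, hc⟩ :=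
          hr b a (b + a - b) b hb ha (sub_nonneg.2 (le_add_of_nonneg_right ha)) hb (by simp)
        refine ⟨c₁₂, c₂₁, p₁₂, p₂₁, ?_, fun h => absurd h hα, fun h => absurd h hα', hc⟩
        have hcomm := hc _ _ p₁₂ le_rfl p₂₁ le_rfl
        have e1 : g₁ = h₁ + (c₁₂ - c₂₁) := by
          have : g₁ = h₁ + (b - a) := by rw [← hd']; simp
          rw [this, ea₂, eb₂]; simp [sub_eq_add_neg, add_assoc, neg_add_rev]
        rw [e1, sub_eq_add_neg c₁₂, (AddCommute.neg_right hcomm : AddCommute c₁₂ (-c₂₁)).eq]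
        simp [sub_eq_add_neg, add_assoc]
  · refine ⟨G.pair β h₁, G.pair (α - β) (-h₁ + g₁), 0, G.pair α' g₂, hb₁, ?_, le_rfl, ha₂,
      ?_, (zero_add _).symm, (add_zero _).symm, ?_, ?_⟩
    · rw [pair_nonneg_iff]; left; omega
    · rw [pair_add, pair_inj]
      exact ⟨by omega, by simp⟩
    · rw [pair_add, pair_inj, add_assoc, hg]
      exact ⟨by omega, by simp⟩
    · intro x y _ _ hy hy'
      simp [le_antisymm hy' hy]

/-! ### Po-groups built from a conjugation-invariant cone. -/

/-- The po-group of differences of a submonoid of the positive cone that is invariant under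
conjugation by its own elements, with this submonoid as positive cone. -/
structure ConeIn (H : PoGroup.{u}) where
  cone : AddSubmonoid H
  nonneg : ∀ a ∈ cone, 0 ≤ a
  conj : ∀ a ∈ cone, ∀ x ∈ cone, a + x - a ∈ cone
  conj_neg : ∀ a ∈ cone, ∀ x ∈ cone, -a + x + a ∈ cone

namespace ConeIn

variable (Z : ConeIn H)

def differences : AddSubgroup H where
  carrier := {h | ∃ a ∈ Z.cone, ∃ b ∈ Z.cone, h = a - b}
  zero_mem' := ⟨0, Z.cone.zero_mem, 0, Z.cone.zero_mem, by simp⟩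
  add_mem' := by
    rintro _ _ ⟨a, ha, b, hb, rfl⟩ ⟨a', ha', b', hb', rfl⟩
    -- Conjugation by `b` carries `-b` past `a'`.
    refine ⟨a + (-b + a' + b), Z.cone.add_mem ha (Z.conj_neg b hb a' ha'), b' + b,
      Z.cone.add_mem hb' hb, ?_⟩
    simp [sub_eq_add_neg, add_assoc, neg_add_rev]
  neg_mem' := by
    rintro _ ⟨a, ha, b, hb, rfl⟩
    exact ⟨b, hb, a, ha, by simp⟩

theorem mem_differences_of_mem {a : H} (ha : a ∈ Z.cone) : a ∈ Z.differences :=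
  ⟨a, ha, 0, Z.cone.zero_mem, by simp⟩

theorem conj_mem {g x : H} (hg : g ∈ Z.differences) (hx : x ∈ Z.cone) : g + x - g ∈ Z.cone := by
  obtain ⟨a, ha, b, hb, rfl⟩ := hg
  have := Z.conj a ha _ (Z.conj_neg b hb x hx)
  convert this using 1
  simp [sub_eq_add_neg, add_assoc, neg_add_rev]

def toPoGroup : PoGroup.{u} where
  carrier := Z.differences
  addGroup := inferInstance
  partialOrder :=
    { le := fun x y => -x.1 + y.1 ∈ Z.cone
      lt := fun x y => -x.1 + y.1 ∈ Z.cone ∧ -y.1 + x.1 ∉ Z.cone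
      le_refl := fun x => by simp
      le_trans := fun x y z h h' => by
        have := Z.cone.add_mem h h'
        simpa [add_assoc] using this
      le_antisymm := fun x y h h' => by
        have h1 := Z.nonneg _ h
        have h2 := Z.nonneg _ h'
        rw [le_neg_add_iff_add_le, add_zero] at h1 h2
        exact Subtype.ext (le_antisymm h1 h2) }
  addLeftMono := ⟨fun a x y h => by
    change -(a.1 + x.1) + (a.1 + y.1) ∈ Z.cone
    have h' : -x.1 + y.1 ∈ Z.cone := h
    simpa [add_assoc, neg_add_rev] using h'⟩
  addRightMono := ⟨fun a x y h => by
    change -(x.1 + a.1) + (y.1 + a.1) ∈ Z.cone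
    have h' : -x.1 + y.1 ∈ Z.cone := h
    have := Z.conj_mem (Z.differences.neg_mem a.2) h'
    simpa [add_assoc, neg_add_rev] using this⟩

/-- The inclusion of the group of differences. -/
def incl : Z.toPoGroup →+ H := Z.differences.subtype

theorem incl_injective : Function.Injective Z.incl := Subtype.val_injective

theorem incl_mem (g : Z.toPoGroup) : Z.incl g ∈ Z.differences := Subtype.property g

theorem exists_incl {h : H} (hh : h ∈ Z.differences) : ∃ g, Z.incl g = h := ⟨⟨h, hh⟩, rfl⟩

theorem le_iff {x y : Z.toPoGroup} : x ≤ y ↔ -Z.incl x + Z.incl y ∈ Z.cone := Iff.rfl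

theorem nonneg_iff {x : Z.toPoGroup} : 0 ≤ x ↔ Z.incl x ∈ Z.cone := by
  rw [le_iff]; simp

theorem directed : Z.toPoGroup.Directed := by
  have key : ∀ x : Z.toPoGroup, ∃ a : Z.toPoGroup, 0 ≤ a ∧ x ≤ a := by
    intro x
    obtain ⟨a, ha, b, hb, h⟩ := Z.incl_mem x
    obtain ⟨a', rfl⟩ := Z.exists_incl (Z.mem_differences_of_mem ha)
    -- If `x = a - b`, then `-x + a = b` is in the cone, so `a` bounds `x`.
    refine ⟨a', Z.nonneg_iff.2 ha, Z.le_iff.2 ?_⟩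
    rw [h]
    have := Z.conj_mem (Z.incl_mem a') hb
    have h2 := Z.conj_mem (Z.differences.neg_mem (Z.incl_mem a')) this
    simpa [sub_eq_add_neg, add_assoc, neg_add_rev] using hb
  intro x y
  obtain ⟨a, ha, hxa⟩ := key x
  obtain ⟨b, hb, hyb⟩ := key y
  exact ⟨a + b, hxa.trans (le_add_of_nonneg_right hb), hyb.trans (le_add_of_nonneg_left ha)⟩

theorem torsionFree (h : H.TorsionFree) : Z.toPoGroup.TorsionFree := by
  intro g k hg hk h0
  refine h (Z.incl g) k (fun h => hg (Z.incl_injective (by simpa using h))) hk ?_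
  rw [← map_zsmul, h0, map_zero]

end ConeIn

end PoGroup

/-! ### Homomorphisms between the intervals: fullness and faithfulness. -/

namespace PoGroup

variable {G H : PoGroup.{u}}

/-- The element `(i, g)` of `Γ(ℤ ×⃗ G, (n, 0))`. -/
noncomputable def GammaLex.mk {n : ℕ} (i : ℕ) (g : G) (hi : i ≤ n) (h0 : i = 0 → 0 ≤ g)
    (h1 : i = n → g ≤ 0) : G.GammaLex n :=
  ⟨G.pair i g, mk_mem i g hi h0 h1⟩

namespace GammaLex

variable {n : ℕ}

/-- The integer component. -/
noncomputable def deg (x : G.GammaLex n) : ℤ := (ofLex x.1).1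

/-- The component in `G`. -/
noncomputable def part (x : G.GammaLex n) : G := (ofLex x.1).2

theorem val_eq (x : G.GammaLex n) : x.1 = G.pair (deg x) (part x) := rfl

theorem ext_pair {x y : G.GammaLex n} (h1 : deg x = deg y) (h2 : part x = part y) : x = y :=
  Subtype.ext (pair_inj.2 ⟨h1, h2⟩)

theorem mem_padd {a b s : G.GammaLex n} :
    s ∈ (G.GammaLex n).padd a b ↔ deg s = deg a + deg b ∧ part s = part a + part b := by
  refine mem_padd_Gamma.trans ?_
  rw [val_eq, val_eq, val_eq, pair_add, pair_inj]

theorem deg_nonneg (x : G.GammaLex n) : 0 ≤ deg x := by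
  obtain ⟨i, g, hi, hx, -, -⟩ := GammaLex_cases x
  have : deg x = i := (pair_inj.1 ((val_eq x).symm.trans hx)).1
  omega

theorem deg_le (x : G.GammaLex n) : deg x ≤ n := by
  obtain ⟨i, g, hi, hx, -, -⟩ := GammaLex_cases x
  have : deg x = i := (pair_inj.1 ((val_eq x).symm.trans hx)).1
  omega

theorem part_nonneg {x : G.GammaLex n} (h : deg x = 0) : 0 ≤ part x := by
  have := x.2.1
  rw [val_eq, pair_nonneg_iff, h] at this
  simpa using this

theorem exists_eq_mk (x : G.GammaLex n) : ∃ i g hi h0 h1, x = mk (G := G) i g hi h0 h1 := by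
  obtain ⟨i, g, hi, hx, h0, h1⟩ := GammaLex_cases x
  exact ⟨i, g, hi, h0, h1, Subtype.ext hx⟩

@[simp] theorem deg_mk (i : ℕ) (g : G) (hi : i ≤ n) (h0 : i = 0 → 0 ≤ g) (h1 : i = n → g ≤ 0) :
    deg (mk i g hi h0 h1) = i := rfl

@[simp] theorem part_mk (i : ℕ) (g : G) (hi : i ≤ n) (h0 : i = 0 → 0 ≤ g) (h1 : i = n → g ≤ 0) :
    part (mk i g hi h0 h1) = g := rfl

variable (φ : (G.GammaLex n).Hom (H.GammaLex n))

/-- The element `(0, g)`. -/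
noncomputable def infinitesimal (hn : 1 ≤ n) (g : G) (hg : 0 ≤ g) : G.GammaLex n :=
  mk 0 g (Nat.zero_le n) (fun _ => hg) (by omega)

@[simp] theorem deg_infinitesimal (hn : 1 ≤ n) (g : G) (hg : 0 ≤ g) :
    deg (infinitesimal hn g hg) = 0 := rfl

@[simp] theorem part_infinitesimal (hn : 1 ≤ n) (g : G) (hg : 0 ≤ g) :
    part (infinitesimal hn g hg) = g := rfl

/-- The element `(i, 0)`. -/
noncomputable def cyc (i : ℕ) (hi : i ≤ n) : G.GammaLex n :=
  mk i 0 hi (fun _ => le_rfl) (fun _ => le_rfl)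

@[simp] theorem deg_cyc (i : ℕ) (hi : i ≤ n) : deg (cyc (G := G) i hi) = i := rfl

@[simp] theorem part_cyc (i : ℕ) (hi : i ≤ n) : part (cyc (G := G) i hi) = 0 := rfl

/-- All multiples `(0, k g)` exist, so `k` times the degree of the image of `(0, g)` is again a
degree, hence at most `n`; `k = n + 1` forces that degree to vanish. -/
theorem deg_map_infinitesimal (hn : 1 ≤ n) (g : G) (hg : 0 ≤ g) :
    deg (φ.toFun (infinitesimal hn g hg)) = 0 := by
  have key : ∀ k : ℕ, deg (φ.toFun (infinitesimal hn (k • g) (nsmul_nonneg hg k))) =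
      k * deg (φ.toFun (infinitesimal hn g hg)) := by
    intro k
    induction k with
    | zero =>
      have h := mem_padd.1 (φ.map_padd (infinitesimal hn _ (nsmul_nonneg hg 0))
        (infinitesimal hn _ (nsmul_nonneg hg 0)) (infinitesimal hn _ (nsmul_nonneg hg 0))
        (mem_padd.2 ⟨by simp, by simp⟩))
      have := h.1
      simp only [Nat.cast_zero, zero_mul]
      omega
    | succ k ih =>
      have h := mem_padd.1 (φ.map_padd (infinitesimal hn _ (nsmul_nonneg hg k))
        (infinitesimal hn g hg) (infinitesimal hn _ (nsmul_nonneg hg (k + 1)))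
        (mem_padd.2 ⟨by simp, by simp [succ_nsmul]⟩))
      rw [h.1, ih]
      push_cast
      ring
  have h1 := key (n + 1)
  have h2 := deg_le (φ.toFun (infinitesimal hn _ (nsmul_nonneg hg (n + 1))))
  have h3 := deg_nonneg (φ.toFun (infinitesimal hn g hg))
  push_cast at h1
  nlinarith

/-- Everything is a multiple of the image of `(1, 0)`, whose `n`-th multiple is the unit `(n, 0)`.
Cancelling `n` gives degree 1, and torsion-freeness of the target kills the group part. -/
theorem map_cyc (hn : 1 ≤ n) (ht : H.TorsionFree) (i : ℕ) (hi : i ≤ n) :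
    φ.toFun (cyc i hi) = cyc i hi := by
  have key : ∀ k : ℕ, ∀ hk : k ≤ n,
      deg (φ.toFun (cyc k hk)) = k * deg (φ.toFun (cyc 1 hn)) ∧
        part (φ.toFun (cyc k hk)) = k • part (φ.toFun (cyc 1 hn)) := by
    intro k
    induction k with
    | zero =>
      intro hk
      have h := mem_padd.1 (φ.map_padd (cyc 0 hk) (cyc 0 hk) (cyc 0 hk)
        (mem_padd.2 ⟨by simp, by simp⟩))
      refine ⟨?_, by simpa using h.2⟩
      have := h.1
      simp only [Nat.cast_zero, zero_mul]
      omega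
    | succ k ih =>
      intro hk
      have ih' := ih (by omega)
      have h := mem_padd.1 (φ.map_padd (cyc k (by omega)) (cyc 1 hn) (cyc (k + 1) hk)
        (mem_padd.2 ⟨by simp, by simp⟩))
      refine ⟨?_, by rw [h.2, ih'.2, succ_nsmul]⟩
      rw [h.1, ih'.1]
      push_cast
      ring
  have hone : φ.toFun (cyc n le_rfl) = cyc n le_rfl := φ.map_one
  have hd := (key n le_rfl).1
  have hp := (key n le_rfl).2
  rw [hone] at hd hp
  simp only [deg_cyc] at hd
  simp only [part_cyc] at hp
  have hd1 : deg (φ.toFun (cyc 1 hn)) = 1 := by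
    have : (n : ℤ) ≠ 0 := by omega
    apply mul_left_cancel₀ this
    rw [← hd, mul_one]
  have hp1 : part (φ.toFun (cyc 1 hn)) = 0 := by
    by_contra hne
    refine ht _ (n : ℤ) hne (by omega) ?_
    rw [natCast_zsmul, ← hp]
  refine ext_pair ?_ ?_
  · rw [(key i hi).1, hd1]; simp
  · rw [(key i hi).2, hp1]; simp

theorem exists_eq_GammaLexMap (hn : 1 ≤ n) (hG : G.Directed) (ht : H.TorsionFree) :
    ∃ F : G →+o H, GammaLexMap F n = φ := by
  classical
  -- The value off the positive cone is irrelevant: the extension uses `f` only on positive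
  -- elements.
  let f : G → H := fun g =>
    if hg : 0 ≤ g then part (φ.toFun (infinitesimal hn g hg)) else 0
  have hf0 : ∀ g (hg : 0 ≤ g), f g = part (φ.toFun (infinitesimal hn g hg)) :=
    fun g hg => dif_pos hg
  have hfn : ∀ g, 0 ≤ g → 0 ≤ f g := fun g hg => by
    rw [hf0 g hg]
    exact part_nonneg (deg_map_infinitesimal φ hn g hg)
  have hf : ∀ a b : G, 0 ≤ a → 0 ≤ b → f (a + b) = f a + f b := by
    intro a b ha hb
    rw [hf0 a ha, hf0 b hb, hf0 _ (add_nonneg ha hb)]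
    exact (mem_padd.1 (φ.map_padd (infinitesimal hn a ha) (infinitesimal hn b hb)
      (infinitesimal hn _ (add_nonneg ha hb)) (mem_padd.2 ⟨by simp, by simp⟩))).2
  obtain ⟨F, hF⟩ := hG.exists_extension f hf
  have hf00 : f 0 = 0 := by simpa using hf 0 0 le_rfl le_rfl
  have hFf : ∀ a, 0 ≤ a → F a = f a := fun a ha => by
    simpa [hf00] using hF a 0 ha le_rfl
  have hmono : Monotone F := by
    intro a b hab
    have h1 : 0 ≤ F (b - a) := by
      rw [hFf _ (sub_nonneg.2 hab)]
      exact hfn _ (sub_nonneg.2 hab)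
    rwa [map_sub, sub_nonneg] at h1
  refine ⟨⟨F, hmono⟩, ?_⟩
  ext1
  funext x
  change (⟨H.pair (deg x) (F (part x)), _⟩ : H.GammaLex n) = φ.toFun x
  suffices h : deg (φ.toFun x) = deg x ∧ part (φ.toFun x) = F (part x) from
    ext_pair h.1.symm h.2.symm
  obtain ⟨i, g, hi, h0, h1, rfl⟩ := exists_eq_mk x
  simp only [deg_mk, part_mk]
  rcases hi.eq_or_lt with rfl | hlt
  -- In top degree no positive infinitesimal can be added to the unit, so `(n, g)` is reached from
  -- above: `(n, g) + (0, -g) = (n, 0)`.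
  · have hg : 0 ≤ -g := by simpa using h1 rfl
    have h := mem_padd.1 (φ.map_padd (mk i g hi h0 h1) (infinitesimal hn (-g) hg) (cyc i hi)
      (mem_padd.2 ⟨by simp, by simp⟩))
    rw [map_cyc φ hn ht, deg_map_infinitesimal, ← hf0 (-g) hg, ← hFf (-g) hg] at h
    simp only [deg_cyc, part_cyc, add_zero, map_neg] at h
    exact ⟨h.1.symm, by simpa using (add_eq_zero_iff_eq_neg.1 h.2.symm)⟩
  -- Below the top degree `(i, a)` is available, and `(i, a - b) + (0, b) = (i, a) = (i, 0) + (0,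
  -- a)` determines the image.
  · obtain ⟨a, b, ha, hb, rfl⟩ := hG.exists_sub g
    have ha' : i = n → a ≤ 0 := by omega
    have h := mem_padd.1 (φ.map_padd (mk i (a - b) hi h0 h1) (infinitesimal hn b hb)
      (mk i a hi (fun _ => ha) ha') (mem_padd.2 ⟨by simp, by simp⟩))
    have h' := mem_padd.1 (φ.map_padd (cyc i hi) (infinitesimal hn a ha)
      (mk i a hi (fun _ => ha) ha') (mem_padd.2 ⟨by simp, by simp⟩))
    rw [h'.1, h'.2, map_cyc φ hn ht, deg_map_infinitesimal, deg_map_infinitesimal,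
      ← hf0 a ha, ← hf0 b hb, ← hFf a ha, ← hFf b hb] at h
    simp only [deg_cyc, part_cyc, add_zero, zero_add] at h
    refine ⟨h.1.symm, ?_⟩
    rw [map_sub, h.2, add_sub_cancel_right]

theorem GammaLexMap_injective (hn : 1 ≤ n) (hG : G.Directed) {f g : G →+o H}
    (h : GammaLexMap f n = GammaLexMap g n) : f = g := by
  have key : ∀ a, 0 ≤ a → f a = g a := fun a ha =>
    congrArg (fun ψ : (G.GammaLex n).Hom (H.GammaLex n) =>
      part (ψ.toFun (infinitesimal hn a ha))) h
  ext x
  obtain ⟨a, b, ha, hb, rfl⟩ := hG.exists_sub x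
  rw [map_sub, map_sub, key a ha, key b hb]

end GammaLex

end PoGroup

/-! ### Degrees, generated ideals and the unique maximal ideal. -/

namespace PseudoEffectAlgebra

variable {E : PseudoEffectAlgebra.{u}} {n : ℕ} {D : Fin (n + 1) → Set E}

/-- `x` lies in the `k`-th slice of `D`. -/
def HasDeg (D : Fin (n + 1) → Set E) (k : ℕ) (x : E) : Prop :=
  ∃ i : Fin (n + 1), (i : ℕ) = k ∧ x ∈ D i

theorem hasDeg_zero_iff {x : E} : HasDeg D 0 x ↔ x ∈ D 0 := by
  constructor
  · rintro ⟨i, hi, hx⟩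
    obtain rfl : i = 0 := Fin.ext hi
    exact hx
  · exact fun h => ⟨0, rfl, h⟩

theorem HasDeg.le {k : ℕ} {x : E} (h : HasDeg D k x) : k ≤ n := by
  obtain ⟨i, rfl, -⟩ := h
  omega

/-- Neutrality of zero is not an axiom, so a right neutral element for `a` is constructed. If `d + 1
= 1` and `a + z = 1`, associativity makes `d + a` a left complement of `z`, so `d + a = a`; the
conjugation axiom moves `d` to the right. -/
theorem le_refl (a : E) : E.Le a a := by
  obtain ⟨z, hz, -⟩ := (E.existsUnique_compl a).1
  obtain ⟨_, -, hu⟩ := (E.existsUnique_compl z).2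
  obtain ⟨d, hd, -⟩ := (E.existsUnique_compl E.one).2
  obtain ⟨s, hs, hs'⟩ := (E.assoc d a z E.one).2 ⟨E.one, hz, hd⟩
  obtain rfl : s = a := (hu s hs').trans (hu a hz).symm
  obtain ⟨c, hc⟩ := (E.conj d s s hs).2
  exact ⟨c, hc⟩

namespace IsDecomposition

variable (hD : E.IsDecomposition n D)
include hD

theorem exists_hasDeg (x : E) : ∃ k, HasDeg D k x := by
  have : x ∈ ⋃ i, D i := hD.cover ▸ Set.mem_univ x
  obtain ⟨i, hi⟩ := Set.mem_iUnion.1 this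
  exact ⟨i, i, rfl, hi⟩

theorem deg_unique {k l : ℕ} {x : E} (h : HasDeg D k x) (h' : HasDeg D l x) : k = l := by
  obtain ⟨i, rfl, hi⟩ := h
  obtain ⟨j, rfl, hj⟩ := h'
  by_contra hne
  have := hD.disjoint i j (fun h => hne (h ▸ rfl))
  exact Set.notMem_empty x (this ▸ ⟨hi, hj⟩)

theorem hasDeg_add {k l : ℕ} {x y s : E} (h : HasDeg D k x) (h' : HasDeg D l y)
    (hs : s ∈ E.padd x y) : HasDeg D (k + l) s := by
  obtain ⟨i, rfl, hi⟩ := h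
  obtain ⟨j, rfl, hj⟩ := h'
  exact hD.add_mem i j x y s hi hj hs

theorem exists_compl {k : ℕ} {x : E} (h : HasDeg D k x) :
    ∃ z, HasDeg D (n - k) z ∧ E.one ∈ E.padd x z := by
  obtain ⟨i, rfl, hi⟩ := h
  obtain ⟨z, hz, -⟩ := (E.existsUnique_compl x).1
  refine ⟨z, ⟨i.rev, by rw [Fin.val_rev]; omega, ?_⟩, hz⟩
  rw [← hD.rightCompls_eq]
  exact ⟨x, hi, hz⟩

end IsDecomposition

theorem IsPerfectDecomposition.dom (hD : E.IsPerfectDecomposition n D) {k l : ℕ} {x y : E}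
    (h : HasDeg D k x) (h' : HasDeg D l y) (hkl : k + l < n) : ∃ s, s ∈ E.padd x y := by
  obtain ⟨i, rfl, hi⟩ := h
  obtain ⟨j, rfl, hj⟩ := h'
  exact Part.dom_iff_mem.1 (hD.add_dom i j hkl x hi y hj)

/-- The elements generated by the lower bounds of `y` under partial addition. -/
inductive Generated (y : E) : E → Prop
  | of_le (x : E) : E.Le x y → Generated y x
  | add (a b s : E) : Generated y a → Generated y b → s ∈ E.padd a b → Generated y s

theorem le_trans {a b c : E} (h : E.Le a b) (h' : E.Le b c) : E.Le a c := by
  obtain ⟨x, hx⟩ := h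
  obtain ⟨y, hy⟩ := h'
  obtain ⟨t, -, ht⟩ := (E.assoc a x y c).1 ⟨b, hx, hy⟩
  exact ⟨t, ht⟩

/-- Riesz decomposition splits an element below `a + b` into a part below `a` and a part below `b`.
-/
theorem Generated.down (hr : E.RDP1) {y x : E} (h : Generated y x) :
    ∀ t, E.Le t x → Generated y t := by
  induction h with
  | of_le x hx => exact fun t ht => .of_le t (le_trans ht hx)
  | add a b s _ _ hs iha ihb =>
    rintro t ⟨t', ht'⟩
    obtain ⟨c₁₁, c₁₂, c₂₁, c₂₂, h1, h2, h3, -, -⟩ := hr a b t t' s hs ht'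
    exact .add _ _ _ (iha c₁₁ ⟨_, h1⟩) (ihb c₂₁ ⟨_, h2⟩) h3

theorem isIdeal_generated (hr : E.RDP1) (y : E) : E.IsIdeal {x | Generated y x} where
  nonempty := ⟨y, .of_le y (le_refl y)⟩
  down a _ hi h := Generated.down hr hi a h
  add_mem i j s hi hj hs := .add i j s hi hj hs

theorem IsIdeal.exists_le_maximal {J : Set E} (hJ : E.IsIdeal J) (h1 : E.one ∉ J) :
    ∃ M, E.IsMaximalIdeal M ∧ J ⊆ M := by
  obtain ⟨M, hJM, hM⟩ := zorn_subset_nonempty {I : Set E | E.IsIdeal I ∧ E.one ∉ I} (by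
    intro c hc hchain ⟨I₀, hI₀⟩
    refine ⟨⋃₀ c, ⟨⟨?_, ?_, ?_⟩, ?_⟩, fun s hs => Set.subset_sUnion_of_mem hs⟩
    · obtain ⟨x, hx⟩ := (hc hI₀).1.nonempty
      exact ⟨x, I₀, hI₀, hx⟩
    · rintro a i ⟨I, hI, hi⟩ h
      exact ⟨I, hI, (hc hI).1.down a i hi h⟩
    · rintro i j s ⟨I, hI, hi⟩ ⟨I', hI', hj⟩ hs
      rcases hchain.total hI hI' with h | h
      · exact ⟨I', hI', (hc hI').1.add_mem i j s (h hi) hj hs⟩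
      · exact ⟨I, hI, (hc hI).1.add_mem i j s hi (h hj) hs⟩
    · rintro ⟨I, hI, h⟩
      exact (hc hI).2 h) J ⟨hJ, h1⟩
  exact ⟨M, ⟨hM.prop.1, hM.prop.2, fun I hI hI1 h =>
    Set.Subset.antisymm (hM.le_of_ge ⟨hI, hI1⟩ h) h⟩, hJM⟩

/-- If the ideal generated by `y` missed `1`, it would lie in a maximal ideal, which can only be `D
0`, although it contains `y`. Once it contains `1` it contains everything below. -/
theorem IsPerfectDecomposition.generated (hD : E.IsPerfectDecomposition n D) (hr : E.RDP1)
    {y : E} (hy : y ∉ D 0) (x : E) : Generated y x := by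
  have h1 : Generated y E.one := by
    by_contra h
    obtain ⟨M, hM, hJM⟩ := (isIdeal_generated hr y).exists_le_maximal h
    rw [hD.unique M hM] at hJM
    exact hy (hJM (.of_le y (le_refl y)))
  obtain ⟨z, hz, -⟩ := (E.existsUnique_compl x).1
  exact h1.down hr x ⟨z, hz⟩

/-! ### Intervals with a central cyclic element: order of the slices and the infinitesimal cone. -/

/-- A representation of `E`, decomposed by `D`, as an interval `[0, n c]` of a po-group with a
central element `c` of the first slice. -/
structure CyclicRep (D : Fin (n + 1) → Set E) (H : PoGroup.{u}) where
  toFun : E → H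
  injective : Function.Injective toFun
  nonneg : ∀ x, 0 ≤ toFun x
  mem_padd : ∀ a b s : E, s ∈ E.padd a b ↔ toFun s = toFun a + toFun b
  cyc : E
  hasDeg_cyc : HasDeg D 1 cyc
  le_unit : ∀ x, toFun x ≤ n • toFun cyc
  surj : ∀ h : H, 0 ≤ h → h ≤ n • toFun cyc → ∃ x, toFun x = h
  zero : toFun E.zero = 0
  one : toFun E.one = n • toFun cyc
  central : ∀ h : H, h + toFun cyc = toFun cyc + h

namespace CyclicRep

variable {H : PoGroup.{u}} (ψ : CyclicRep D H) (hD : E.IsPerfectDecomposition n D)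

theorem le_iff {x y : E} : E.Le x y ↔ ψ.toFun x ≤ ψ.toFun y := by
  constructor
  · rintro ⟨c, hc⟩
    rw [(ψ.mem_padd _ _ _).1 hc]
    exact le_add_of_nonneg_right (ψ.nonneg c)
  · intro h
    obtain ⟨c, hc⟩ := ψ.surj (-ψ.toFun x + ψ.toFun y)
      (by simpa [le_neg_add_iff_add_le] using h)
      (_root_.le_trans (by simpa [neg_add_le_iff_le_add] using ψ.nonneg x) (ψ.le_unit y))
    exact ⟨c, (ψ.mem_padd _ _ _).2 (by simp [hc])⟩

theorem nsmul_cyc_comm (k : ℕ) (h : H) : h + k • ψ.toFun ψ.cyc = k • ψ.toFun ψ.cyc + h :=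
  (AddCommute.nsmul_right (ψ.central h : AddCommute h _) k).eq

include hD

/-- The complement `z` of `y` has degree `n - l`, so `x + z` has degree below `n` and exists. It is
at most `1 = y + z`, and `z` cancels. -/
theorem le_of_deg_lt {k l : ℕ} {x y : E} (hx : HasDeg D k x) (hy : HasDeg D l y) (h : k < l) :
    ψ.toFun x ≤ ψ.toFun y := by
  obtain ⟨z, hz, hyz⟩ := hD.decomposition.exists_compl hy
  have := hy.le
  obtain ⟨s, hs⟩ := hD.dom hx hz (by omega)
  have h1 := ψ.le_unit s
  rw [(ψ.mem_padd _ _ _).1 hs, ← ψ.one, (ψ.mem_padd _ _ _).1 hyz] at h1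
  exact le_of_add_le_add_right h1

theorem exists_nsmul_cyc (k : ℕ) (hk : k ≤ n) :
    ∃ x, HasDeg D k x ∧ ψ.toFun x = k • ψ.toFun ψ.cyc := by
  induction k with
  | zero =>
    obtain ⟨x, hx⟩ := ψ.surj 0 le_rfl (nsmul_nonneg (ψ.nonneg _) n)
    obtain ⟨k, hk⟩ := hD.decomposition.exists_hasDeg x
    -- From `0 + 0 = 0` the degree `k` of zero satisfies `k + k = k`.
    have := hD.decomposition.hasDeg_add hk hk ((ψ.mem_padd x x x).2 (by simp [hx]))
    have h0 := hD.decomposition.deg_unique hk this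
    obtain rfl : k = 0 := by omega
    exact ⟨x, hk, by simp [hx]⟩
  | succ k ih =>
    obtain ⟨x, hx, hxe⟩ := ih (by omega)
    obtain ⟨s, hs⟩ := ψ.surj ((k + 1) • ψ.toFun ψ.cyc) (nsmul_nonneg (ψ.nonneg _) _)
      (nsmul_le_nsmul_left (ψ.nonneg _) hk)
    exact ⟨s, hD.decomposition.hasDeg_add hx ψ.hasDeg_cyc
      ((ψ.mem_padd _ _ _).2 (by rw [hs, hxe, succ_nsmul])), hs⟩

theorem hasDeg_of_add_eq {k l : ℕ} {x y s : E} (hx : HasDeg D k x) (hs : HasDeg D (k + l) s)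
    (h : ψ.toFun s = ψ.toFun x + ψ.toFun y) : HasDeg D l y := by
  obtain ⟨m, hm⟩ := hD.decomposition.exists_hasDeg y
  have := hD.decomposition.deg_unique hs
    (hD.decomposition.hasDeg_add hx hm ((ψ.mem_padd _ _ _).2 h))
  obtain rfl : l = m := by omega
  exact hm

theorem hasDeg_of_add_eq_left {k l : ℕ} {x y s : E} (hy : HasDeg D l y) (hs : HasDeg D (k + l) s)
    (h : ψ.toFun s = ψ.toFun x + ψ.toFun y) : HasDeg D k x := by
  obtain ⟨m, hm⟩ := hD.decomposition.exists_hasDeg x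
  have := hD.decomposition.deg_unique hs
    (hD.decomposition.hasDeg_add hm hy ((ψ.mem_padd _ _ _).2 h))
  obtain rfl : k = m := by omega
  exact hm

/-- The sum of an element of degree `k < n` and an infinitesimal one. -/
theorem exists_add_zero {k : ℕ} (hk : k < n) {x y : E} (hx : HasDeg D k x)
    (hy : HasDeg D 0 y) : ∃ s, HasDeg D k s ∧ ψ.toFun s = ψ.toFun x + ψ.toFun y := by
  obtain ⟨s, hs⟩ := hD.dom hx hy (by omega)
  exact ⟨s, hD.decomposition.hasDeg_add hx hy hs, (ψ.mem_padd _ _ _).1 hs⟩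

/-- The image of the infinitesimal elements, as a cone. -/
def cone : H.ConeIn where
  cone :=
    { carrier := {h | ∃ x, HasDeg D 0 x ∧ ψ.toFun x = h}
      zero_mem' := by simpa using ψ.exists_nsmul_cyc hD 0 (Nat.zero_le n)
      add_mem' := by
        rintro _ _ ⟨x, hx, rfl⟩ ⟨y, hy, rfl⟩
        exact ψ.exists_add_zero hD ψ.hasDeg_cyc.le hx hy }
  nonneg := by
    rintro _ ⟨x, -, rfl⟩
    exact ψ.nonneg x
  conj := by
    rintro _ ⟨a, ha, rfl⟩ _ ⟨x, hx, rfl⟩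
    -- Two infinitesimals can be added because `0 + 0 < n`, and `1 ≤ n` since the cyclic element has
    -- degree 1. The conjugation axiom then supplies the conjugate inside `E`.
    obtain ⟨s, hs⟩ := hD.dom ha hx ψ.hasDeg_cyc.le
    obtain ⟨d, hd⟩ := (E.conj a x s hs).1
    have h1 := (ψ.mem_padd _ _ _).1 hs
    have h2 := (ψ.mem_padd _ _ _).1 hd
    exact ⟨d, ψ.hasDeg_of_add_eq_left hD ha (hD.decomposition.hasDeg_add ha hx hs) h2,
      by rw [← h1, h2]; simp⟩
  conj_neg := by
    rintro _ ⟨a, ha, rfl⟩ _ ⟨x, hx, rfl⟩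
    obtain ⟨s, hs⟩ := hD.dom hx ha ψ.hasDeg_cyc.le
    obtain ⟨d, hd⟩ := (E.conj x a s hs).2
    have h1 := (ψ.mem_padd _ _ _).1 hs
    have h2 := (ψ.mem_padd _ _ _).1 hd
    exact ⟨d, ψ.hasDeg_of_add_eq hD ha (hD.decomposition.hasDeg_add hx ha hs) h2,
      by rw [add_assoc, ← h1, h2]; simp⟩

end CyclicRep

end PseudoEffectAlgebra

/-! ### Each slice is a multiple of the cyclic element plus infinitesimal differences. -/

namespace PseudoEffectAlgebra

variable {E : PseudoEffectAlgebra.{u}} {n : ℕ} {D : Fin (n + 1) → Set E}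

namespace CyclicRep

variable {H : PoGroup.{u}} (ψ : CyclicRep D H) (hD : E.IsPerfectDecomposition n D)

include hD

theorem hasDeg_zero_of_mem_padd {a b s : E} (hs : HasDeg D 0 s) (h : s ∈ E.padd a b) :
    HasDeg D 0 a ∧ HasDeg D 0 b := by
  obtain ⟨k, hk⟩ := hD.decomposition.exists_hasDeg a
  obtain ⟨l, hl⟩ := hD.decomposition.exists_hasDeg b
  have := hD.decomposition.deg_unique hs (hD.decomposition.hasDeg_add hk hl h)
  obtain ⟨rfl, rfl⟩ : k = 0 ∧ l = 0 := by omega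
  exact ⟨hk, hl⟩

theorem mem_differences {x : E} (hx : HasDeg D 0 x) : ψ.toFun x ∈ (ψ.cone hD).differences :=
  (ψ.cone hD).mem_differences_of_mem ⟨x, hx, rfl⟩

/-- Induction along the generation of `x`: in a sum of degree 1 one summand has degree 1 and the
other is infinitesimal, hence absorbed into `g` or `g'`. An element of degree 1 below `y` differs
from `y` by an infinitesimal. -/
theorem eq_of_generated {y : E} (hy : HasDeg D 1 y) {x : E} (h : Generated y x) :
    HasDeg D 1 x → ∃ g ∈ (ψ.cone hD).differences, ∃ g' ∈ (ψ.cone hD).differences,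
      ψ.toFun x = g + ψ.toFun y + g' := by
  induction h with
  | of_le x hxy =>
    intro hx
    obtain ⟨w, hw⟩ := hxy
    have hw' := (ψ.mem_padd _ _ _).1 hw
    have hw0 : HasDeg D 0 w := ψ.hasDeg_of_add_eq hD hx hy hw'
    exact ⟨0, zero_mem _, -ψ.toFun w, neg_mem (ψ.mem_differences hD hw0), by rw [hw']; simp⟩
  | add a b s _ _ hs iha ihb =>
    intro hs1
    have hs' := (ψ.mem_padd _ _ _).1 hs
    obtain ⟨k, hk⟩ := hD.decomposition.exists_hasDeg a
    obtain ⟨l, hl⟩ := hD.decomposition.exists_hasDeg b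
    have := hD.decomposition.deg_unique hs1 (hD.decomposition.hasDeg_add hk hl hs)
    rcases (by omega : (k = 0 ∧ l = 1) ∨ (k = 1 ∧ l = 0)) with ⟨rfl, rfl⟩ | ⟨rfl, rfl⟩
    · obtain ⟨g, hg, g', hg', h⟩ := ihb hl
      exact ⟨ψ.toFun a + g, add_mem (ψ.mem_differences hD hk) hg, g', hg',
        by rw [hs', h]; simp [add_assoc]⟩
    · obtain ⟨g, hg, g', hg', h⟩ := iha hk
      exact ⟨g, hg, g' + ψ.toFun b, add_mem hg' (ψ.mem_differences hD hl),
        by rw [hs', h]; simp [add_assoc]⟩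

/-- The generation lemma is applied to the cyclic element, generated from `y`; centrality then
collects both correction terms on the right. -/
theorem exists_eq_cyc_add (hr : E.RDP1) {y : E} (hy : HasDeg D 1 y) :
    ∃ g ∈ (ψ.cone hD).differences, ψ.toFun y = ψ.toFun ψ.cyc + g := by
  have hy0 : y ∉ D 0 := fun h =>
    one_ne_zero (hD.decomposition.deg_unique hy (hasDeg_zero_iff.2 h))
  obtain ⟨g, hg, g', hg', h⟩ :=
    ψ.eq_of_generated hD hy (hD.generated hr hy0 ψ.cyc) ψ.hasDeg_cyc
  refine ⟨-g + -g', add_mem (neg_mem hg) (neg_mem hg'), ?_⟩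
  calc ψ.toFun y = -g + (g + ψ.toFun y + g') + -g' := by simp [add_assoc]
    _ = _ := by rw [← h, ψ.central, add_assoc]

/-- An element of degree `k + 1` lies above `k` times the cyclic element, and the difference has
degree 1. -/
theorem exists_eq_nsmul_add (hr : E.RDP1) {k : ℕ} {y : E} (hy : HasDeg D k y) :
    ∃ g ∈ (ψ.cone hD).differences, ψ.toFun y = k • ψ.toFun ψ.cyc + g := by
  cases k with
  | zero => exact ⟨_, ψ.mem_differences hD hy, by simp⟩
  | succ k =>
    obtain ⟨x, hx, hxe⟩ := ψ.exists_nsmul_cyc hD k (by have := hy.le; omega)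
    obtain ⟨z, hz⟩ := ψ.le_iff.2 (ψ.le_of_deg_lt hD hx hy (Nat.lt_succ_self k))
    have hz' := (ψ.mem_padd _ _ _).1 hz
    obtain ⟨g, hg, h⟩ := ψ.exists_eq_cyc_add hD hr (ψ.hasDeg_of_add_eq hD hx hy hz')
    exact ⟨g, hg, by rw [hz', hxe, h, succ_nsmul, add_assoc]⟩

include ψ in
theorem hasDeg_one : HasDeg D n E.one := by
  obtain ⟨x, hx, h⟩ := ψ.exists_nsmul_cyc hD n le_rfl
  obtain rfl : x = E.one := ψ.injective (h.trans ψ.one.symm)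
  exact hx

/-- The po-group of differences of infinitesimal elements. -/
abbrev infGroup : PoGroup.{u} := (ψ.cone hD).toPoGroup

theorem exists_of_nsmul_add (k : ℕ) (hk : k ≤ n) (g : ψ.infGroup hD) (h0 : k = 0 → 0 ≤ g)
    (hn : k = n → g ≤ 0) :
    ∃ x, HasDeg D k x ∧ ψ.toFun x = k • ψ.toFun ψ.cyc + (ψ.cone hD).incl g := by
  have h1 := ψ.hasDeg_cyc.le
  rcases Nat.eq_zero_or_pos k with rfl | hpos
  · obtain ⟨x, hx, h⟩ := (ψ.cone hD).nonneg_iff.1 (h0 rfl)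
    exact ⟨x, hx, by simp [h]⟩
  -- For `k > 0`, subtracting an infinitesimal from an element of degree `k` stays in the interval
  -- because lower slices lie below higher ones. In top degree the subtraction starts at the unit,
  -- below it at `k c + a` with `g = a - b`.
  suffices key : ∃ s b, HasDeg D k s ∧ HasDeg D 0 b ∧
      ψ.toFun s - ψ.toFun b = k • ψ.toFun ψ.cyc + (ψ.cone hD).incl g by
    obtain ⟨s, b, hs, hb, h⟩ := key
    obtain ⟨x, hx⟩ := ψ.surj (ψ.toFun s - ψ.toFun b)
      (sub_nonneg.2 (ψ.le_of_deg_lt hD hb hs hpos))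
      (_root_.le_trans (by simpa [sub_eq_add_neg] using ψ.nonneg b) (ψ.le_unit s))
    exact ⟨x, ψ.hasDeg_of_add_eq_left hD (k := k) hb hs (by rw [hx]; simp), hx.trans h⟩
  rcases hk.eq_or_lt with rfl | hlt
  · obtain ⟨b, hb, h⟩ := (ψ.cone hD).nonneg_iff.1 (neg_nonneg.2 (hn rfl))
    exact ⟨E.one, b, ψ.hasDeg_one hD, hb, by rw [h, ψ.one]; simp⟩
  · obtain ⟨_, ⟨a, ha, rfl⟩, _, ⟨b, hb, rfl⟩, hab⟩ := (ψ.cone hD).incl_mem g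
    obtain ⟨x, hx, hxe⟩ := ψ.exists_nsmul_cyc hD k hk
    obtain ⟨s, hs, h⟩ := ψ.exists_add_zero hD hlt hx ha
    exact ⟨s, b, hs, hb, by rw [h, hxe, hab, add_sub_assoc]⟩

theorem nsmul_add_incl (i j : ℕ) (g h : ψ.infGroup hD) :
    (i + j) • ψ.toFun ψ.cyc + (ψ.cone hD).incl (g + h) =
      i • ψ.toFun ψ.cyc + (ψ.cone hD).incl g + (j • ψ.toFun ψ.cyc + (ψ.cone hD).incl h) := by
  rw [map_add, add_nsmul, add_assoc, add_assoc, ← add_assoc ((ψ.cone hD).incl g),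
    ψ.nsmul_cyc_comm, add_assoc]

open PoGroup in
theorem exists_iso (hr : E.RDP1) :
    Nonempty (((ψ.infGroup hD).GammaLex n).Iso E) := by
  -- Quantifying over all presentations of `x` makes the chosen image usable with any pair `(i, g)`
  -- representing it.
  have key : ∀ x : (ψ.infGroup hD).GammaLex n, ∃ y : E, ∀ i g hi h0 h1,
      x = GammaLex.mk i g hi h0 h1 →
        HasDeg D i y ∧ ψ.toFun y = i • ψ.toFun ψ.cyc + (ψ.cone hD).incl g := by
    intro x
    obtain ⟨i, g, hi, h0, h1, rfl⟩ := GammaLex.exists_eq_mk x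
    obtain ⟨y, hy⟩ := ψ.exists_of_nsmul_add hD i hi g h0 h1
    refine ⟨y, fun i' g' _ _ _ h => ?_⟩
    have hd := congrArg GammaLex.deg h
    have hp := congrArg GammaLex.part h
    simp only [GammaLex.deg_mk, GammaLex.part_mk, Nat.cast_inj] at hd hp
    subst hd hp
    exact hy
  choose f hf using key
  have hpadd : ∀ a b s, s ∈ ((ψ.infGroup hD).GammaLex n).padd a b ↔ f s ∈ E.padd (f a) (f b) := by
    intro a b s
    obtain ⟨i, g, hi, h0, h1, ha⟩ := GammaLex.exists_eq_mk a
    obtain ⟨j, g', hj, h0', h1', hb⟩ := GammaLex.exists_eq_mk b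
    obtain ⟨k, g'', hk, h0'', h1'', hs⟩ := GammaLex.exists_eq_mk s
    have fa := hf a _ _ _ _ _ ha
    have fb := hf b _ _ _ _ _ hb
    have fs := hf s _ _ _ _ _ hs
    rw [GammaLex.mem_padd, ha, hb, hs]
    simp only [GammaLex.deg_mk, GammaLex.part_mk]
    rw [← ha, ← hb, ← hs]
    constructor
    · rintro ⟨hd, rfl⟩
      obtain rfl : k = i + j := by exact_mod_cast hd
      rw [ψ.mem_padd, fa.2, fb.2, fs.2, ψ.nsmul_add_incl hD]
    · intro h
      obtain rfl := hD.decomposition.deg_unique fs.1 (hD.decomposition.hasDeg_add fa.1 fb.1 h)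
      refine ⟨by push_cast; rfl, ?_⟩
      rw [ψ.mem_padd, fa.2, fb.2, fs.2, ← ψ.nsmul_add_incl hD] at h
      exact (ψ.cone hD).incl_injective (add_left_cancel h)
  have hbij : Function.Bijective f := by
    constructor
    · intro a b hab
      obtain ⟨i, g, hi, h0, h1, ha⟩ := GammaLex.exists_eq_mk a
      obtain ⟨j, g', hj, h0', h1', hb⟩ := GammaLex.exists_eq_mk b
      have fa := hf a _ _ _ _ _ ha
      have fb := hf b _ _ _ _ _ hb
      rw [hab] at fa
      obtain rfl := hD.decomposition.deg_unique fa.1 fb.1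
      obtain rfl := (ψ.cone hD).incl_injective (add_left_cancel (fa.2.symm.trans fb.2))
      exact ha.trans hb.symm
    · intro y
      obtain ⟨k, hk⟩ := hD.decomposition.exists_hasDeg y
      obtain ⟨h, hh, hy⟩ := ψ.exists_eq_nsmul_add hD hr hk
      obtain ⟨g, rfl⟩ := (ψ.cone hD).exists_incl hh
      have h0 : k = 0 → 0 ≤ g := by
        rintro rfl
        exact (ψ.cone hD).nonneg_iff.2 ⟨y, hk, by simpa using hy⟩
      have h1 : k = n → g ≤ 0 := by
        rintro rfl
        -- In top degree the complement is infinitesimal and equals `-g`, so `g ≤ 0`.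
        obtain ⟨z, hz, hyz⟩ := hD.decomposition.exists_compl hk
        rw [ψ.mem_padd, ψ.one, hy, add_assoc, left_eq_add] at hyz
        rw [← neg_nonneg, (ψ.cone hD).nonneg_iff, map_neg, neg_eq_of_add_eq_zero_right hyz]
        exact ⟨z, by simpa using hz, rfl⟩
      exact ⟨GammaLex.mk k g hk.le h0 h1,
        ψ.injective ((hf _ k g hk.le h0 h1 rfl).2.trans hy.symm)⟩
  refine ⟨⟨Equiv.ofBijective f hbij, ?_, ?_, hpadd⟩⟩
  · apply ψ.injective
    rw [ψ.zero]
    have := hf (((ψ.infGroup hD).GammaLex n).zero) 0 0 (Nat.zero_le n) (fun _ => le_rfl)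
      (fun _ => le_rfl) rfl
    simpa using this.2
  · apply ψ.injective
    rw [ψ.one]
    have := hf (((ψ.infGroup hD).GammaLex n).one) n 0 le_rfl (fun _ => le_rfl)
      (fun _ => le_rfl) rfl
    simpa using this.2

/-- Summands of infinitesimals are infinitesimal, so a refinement in `E` stays in the cone. Elements
of the group between `0` and an entry come from elements of `E` below that entry, so their
commutation is inherited. -/
theorem rdp1_infGroup (hr : E.RDP1) : (ψ.infGroup hD).RDP1 := by
  intro a₁ a₂ b₁ b₂ ha₁ ha₂ hb₁ hb₂ hab
  obtain ⟨x₁, hx₁, ex₁⟩ := (ψ.cone hD).nonneg_iff.1 ha₁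
  obtain ⟨x₂, hx₂, ex₂⟩ := (ψ.cone hD).nonneg_iff.1 ha₂
  obtain ⟨y₁, hy₁, ey₁⟩ := (ψ.cone hD).nonneg_iff.1 hb₁
  obtain ⟨y₂, hy₂, ey₂⟩ := (ψ.cone hD).nonneg_iff.1 hb₂
  obtain ⟨s, hs⟩ := hD.dom hx₁ hx₂ ψ.hasDeg_cyc.le
  have hs' : s ∈ E.padd y₁ y₂ := by
    rw [ψ.mem_padd, ey₁, ey₂, ← map_add, ← hab, map_add, ← ex₁, ← ex₂, ← ψ.mem_padd]
    exact hs
  obtain ⟨c₁₁, c₁₂, c₂₁, c₂₂, h₁, h₂, h₃, h₄, hc⟩ := hr x₁ x₂ y₁ y₂ s hs hs'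
  have d₁ := hasDeg_zero_of_mem_padd hD hx₁ h₁
  have d₂ := hasDeg_zero_of_mem_padd hD hx₂ h₂
  have lift : ∀ x, HasDeg D 0 x → ∃ g : ψ.infGroup hD, 0 ≤ g ∧ (ψ.cone hD).incl g = ψ.toFun x := by
    intro x hx
    obtain ⟨g, hg⟩ := (ψ.cone hD).exists_incl (ψ.mem_differences hD hx)
    exact ⟨g, (ψ.cone hD).nonneg_iff.2 ⟨x, hx, hg.symm⟩, hg⟩
  obtain ⟨g₁₁, p₁₁, e₁₁⟩ := lift _ d₁.1
  obtain ⟨g₁₂, p₁₂, e₁₂⟩ := lift _ d₁.2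
  obtain ⟨g₂₁, p₂₁, e₂₁⟩ := lift _ d₂.1
  obtain ⟨g₂₂, p₂₂, e₂₂⟩ := lift _ d₂.2
  rw [ψ.mem_padd] at h₁ h₂ h₃ h₄
  refine ⟨g₁₁, g₁₂, g₂₁, g₂₂, p₁₁, p₁₂, p₂₁, p₂₂, ?_, ?_, ?_, ?_, ?_⟩
  · apply (ψ.cone hD).incl_injective
    rw [map_add, e₁₁, e₁₂, ← ex₁, h₁]
  · apply (ψ.cone hD).incl_injective
    rw [map_add, e₂₁, e₂₂, ← ex₂, h₂]
  · apply (ψ.cone hD).incl_injective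
    rw [map_add, e₁₁, e₂₁, ← ey₁, h₃]
  · apply (ψ.cone hD).incl_injective
    rw [map_add, e₁₂, e₂₂, ← ey₂, h₄]
  · intro x y hx hx' hy hy'
    have lower : ∀ (x g : ψ.infGroup hD) (c : E), 0 ≤ x → x ≤ g →
        (ψ.cone hD).incl g = ψ.toFun c → ∃ z, E.Le z c ∧ ψ.toFun z = (ψ.cone hD).incl x := by
      intro x g c hx hxg hg
      obtain ⟨z, -, hz⟩ := (ψ.cone hD).nonneg_iff.1 hx
      refine ⟨z, ψ.le_iff.2 ?_, hz⟩
      have := (ψ.cone hD).nonneg _ ((ψ.cone hD).le_iff.1 hxg)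
      rw [le_neg_add_iff_add_le, add_zero] at this
      rwa [hz, ← hg]
    obtain ⟨z, hz, ez⟩ := lower x g₁₂ c₁₂ hx hx' e₁₂
    obtain ⟨w, hw, ew⟩ := lower y g₂₁ c₂₁ hy hy' e₂₁
    obtain ⟨t, ht, ht'⟩ := hc z w hz hw
    rw [ψ.mem_padd] at ht ht'
    apply (ψ.cone hD).incl_injective
    rw [map_add, map_add, ← ez, ← ew, ← ht, ← ht']

end CyclicRep

/-! ### Assembling the equivalence. -/

theorem IsStrongPerfect.exists_cyclicRep (h : E.IsStrongPerfect n) :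
    ∃ (D : Fin (n + 1) → Set E) (_ : E.IsPerfectDecomposition n D) (H : PoGroup.{u})
      (_ : CyclicRep D H), H.TorsionFree := by
  obtain ⟨-, D, hD, H, e, he, φ, ht, i, c, hi, hc, hnc, hcomm⟩ := h
  refine ⟨D, hD, H, ?_, ht⟩
  exact
    { toFun := fun x => (φ.toEquiv x).1
      injective := Subtype.val_injective.comp φ.toEquiv.injective
      nonneg := fun x => (φ.toEquiv x).2.1
      mem_padd := fun a b s => (φ.map_padd a b s).trans PoGroup.mem_padd_Gamma
      cyc := c
      hasDeg_cyc := ⟨i, hi, hc⟩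
      le_unit := fun x => (φ.toEquiv x).2.2.trans_eq hnc.symm
      surj := fun h h0 h1 => ⟨φ.toEquiv.symm ⟨h, h0, h1.trans_eq hnc⟩,
        congrArg Subtype.val (φ.toEquiv.apply_symm_apply _)⟩
      zero := congrArg Subtype.val φ.map_zero
      one := (congrArg Subtype.val φ.map_one).trans hnc.symm
      central := hcomm }

/-- The category isomorphism underlying an isomorphism of pseudo-effect algebras. -/
def Iso.toCatIso {X Y : StrongPerfectPEACat.{u} n} (φ : X.obj.Iso Y.obj) : X ≅ Y where
  hom := (⟨φ.toEquiv, φ.map_zero, φ.map_one, fun a b s => (φ.map_padd a b s).1⟩ : Hom X.obj Y.obj)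
  inv := (⟨φ.toEquiv.symm, by rw [← φ.map_zero]; simp, by rw [← φ.map_one]; simp,
    fun a b s h => (φ.map_padd _ _ _).2 (by simpa using h)⟩ : Hom Y.obj X.obj)
  hom_inv_id := Hom.ext (funext φ.toEquiv.symm_apply_apply)
  inv_hom_id := Hom.ext (funext φ.toEquiv.apply_symm_apply)

end PseudoEffectAlgebra

theorem theorem6p14 (n : ℕ) (hn : 1 ≤ n) : (functorE.{u} n hn).IsEquivalence := by
  have faithful : (functorE.{u} n hn).Faithful :=
    ⟨fun {X _} _ _ h => PoGroup.GammaLex.GammaLexMap_injective hn X.directed h⟩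
  have full : (functorE.{u} n hn).Full :=
    ⟨fun {X Y} φ => PoGroup.GammaLex.exists_eq_GammaLexMap φ hn X.directed Y.torsionFree⟩
  have essSurj : (functorE.{u} n hn).EssSurj := by
    refine ⟨fun Y => ?_⟩
    obtain ⟨D, hD, H, ψ, ht⟩ := Y.strongPerfect.exists_cyclicRep
    have hr := Y.strongPerfect.1
    obtain ⟨φ⟩ := ψ.exists_iso hD hr
    have hdir : (ψ.infGroup hD).Directed := (ψ.cone hD).directed
    let X : TFPoGroupCat.{u} := ⟨ψ.infGroup hD, (ψ.cone hD).torsionFree ht, hdir,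
      (ψ.rdp1_infGroup hD hr).lexInt hdir⟩
    exact ⟨X, ⟨PseudoEffectAlgebra.Iso.toCatIso (X := (functorE n hn).obj X) φ⟩⟩
  exact {}
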